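/- Let $r,m,p\ge 0$ be integers, let $\mathbb{C}^+$ be the open right half-plane, and let $\mathcal{H}_2$ be the Hardy space of analytic functions $F:\mathbb{C}^+\to\mathbb{C}^{p\times m}$ with $\sup_{\xi>0}\int_{-\infty}^{\infty}\|F(\xi+\mathrm{i}\omega)\|_{\mathrm F}^2\,d\omega<\infty$, with the inner product $\langle F,G\rangle=\frac{1}{2\pi}\int_{-\infty}^{\infty}\operatorname{tr}\bigl(F(\mathrm{i}\omega)^*G(\mathrm{i}\omega)\bigr)\,d\omega$, where $F(\mathrm{i}\,\cdot)$ and $G(\mathrm{i}\,\cdot)$ are the boundary values on the imaginary axis, i.e. the limits in $L^2(\mathbb{R})$ of $F(\xi+\mathrm{i}\,\cdot)$ and $G(\xi+\mathrm{i}\,\cdot)$ as $\xi\to0^+$. Let $\Sigma=\Sigma^-_{r,m,p}(\mathbb{C})\subset\mathcal{H}_2$ be the set of functions $\hat C(sI-\hat A)^{-1}\hat B$ with $\hat A\in\mathbb{C}^{r\times r}$ Hurwitz (all eigenvalues in the open left half-plane), $\hat B\in\mathbb{C}^{r\times m}$, $\hat C\in\mathbb{C}^{p\times r}$, and $(\hat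 A,\hat B,\hat C)$ minimal (no realization of the same transfer function has order smaller than $r$). For $\hat H\in\Sigma$ let the tangent space $\mathrm{T}_{\hat H}\Sigma\subset\mathcal{H}_2$ be the set of all velocities $\gamma'(0)$ of smooth curves $\gamma:(-\varepsilon,\varepsilon)\to\mathcal{H}_2$ with values in $\Sigma$ and $\gamma(0)=\hat H$. Let $H\in\mathcal{H}_2$, and let $\hat H\in\Sigma$ have a pole-residue form \[\hat H(s)=\sum_{i=1}^r\frac{c_ib_i^*}{s-\lambda_i},\qquad b_i\in\mathbb{C}^m,\ c_i\in\mathbb{C}^p,\] with pairwise distinct poles $\lambda_1,\dots,\lambda_r$. Then $H-\hat H\perp \mathrm{T}_{\hat H}\Sigma$ in $\mathcal{H}_2$ if and only if, for all $i=1,\dots,r$, \[H(-\overline{\lambda_i})\,b_i=\hat H(-\overline{\lambda_i})\,b_i,\qquad c_i^*H(-\overline{\lambda_i})=c_i^*\hat H(-\overline{\lambda_i}),\qquad c_i^*H'(-\overline{\lambda_i})\,b_i=c_i^*\hat H'(-\overline{\lambda_i})\,b_i .\] -/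

import Mathlib

noncomputable section

namespace H2Opt

open MeasureTheory Filter Topology

open scoped ContDiff Matrix

/-! ### The Hardy space of the open right half-plane

An element of the Hardy space is an analytic function on the open right half-plane
`{s | 0 < s.re}` with values in the `p × m` matrices. It is represented by a function on `ℂ`
of which only the values on the open right half-plane are ever used. -/

/-- The Hilbert space of `p × m` complex matrices with the Frobenius norm. -/
abbrev FrobSpace (p m : ℕ) : Type := EuclideanSpace ℂ (Fin p × Fin m)

/-- A matrix regarded as an element of the Frobenius Hilbert space. -/
def vec {p m : ℕ} (M : Matrix (Fin p) (Fin m) ℂ) : FrobSpace p m :=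
  WithLp.toLp 2 (fun ij => M ij.1 ij.2)

/-- An element of the Frobenius Hilbert space regarded as a matrix. -/
def unvec {p m : ℕ} (v : FrobSpace p m) : Matrix (Fin p) (Fin m) ℂ :=
  Matrix.of (fun i j => v (i, j))

/-- The restriction `y ↦ F (ξ + i y)` of `F` to the vertical line `Re s = ξ`. -/
def slice {p m : ℕ} (F : ℂ → Matrix (Fin p) (Fin m) ℂ) (ξ : ℝ) (y : ℝ) : FrobSpace p m :=
  vec (F ((ξ : ℂ) + (y : ℂ) * Complex.I))

/-- Membership in the Hardy space `H₂` of the open right half-plane: `F` is analytic there, and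
`sup_{ξ > 0} ∫ ‖F (ξ + i y)‖_F² dy < ∞`. -/
structure MemH2 {p m : ℕ} (F : ℂ → Matrix (Fin p) (Fin m) ℂ) : Prop where
  analytic : ∀ i j, DifferentiableOn ℂ (fun s => F s i j) {s : ℂ | 0 < s.re}
  bounded : (⨆ ξ ∈ Set.Ioi (0 : ℝ), ∫⁻ y : ℝ, ‖slice F ξ y‖ₑ ^ 2) < ⊤

open Classical in
/-- The restriction of `F` to the line `Re s = ξ` as an element of `L²(ℝ)`
(the default value `0` is never taken for `F` in the Hardy space and `ξ > 0`). -/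
def sliceLp {p m : ℕ} (F : ℂ → Matrix (Fin p) (Fin m) ℂ) (ξ : ℝ) :
    Lp (FrobSpace p m) 2 (volume : Measure ℝ) :=
  if h : MemLp (slice F ξ) 2 (volume : Measure ℝ) then h.toLp (slice F ξ) else 0

/-- The extension `y ↦ F (i y)` of a Hardy function to the imaginary axis: the limit in `L²(ℝ)`
of the restrictions `y ↦ F (ξ + i y)` as `ξ → 0⁺`. -/
def boundary {p m : ℕ} (F : ℂ → Matrix (Fin p) (Fin m) ℂ) :
    Lp (FrobSpace p m) 2 (volume : Measure ℝ) :=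
  limUnder (𝓝[>] (0 : ℝ)) (sliceLp F)

/-- The inner product of the Hardy space,
`⟨F, G⟩ = (1 / 2π) ∫ tr (F (i y)* G (i y)) dy`. -/
def innerH2 {p m : ℕ} (F G : ℂ → Matrix (Fin p) (Fin m) ℂ) : ℂ :=
  (1 / (2 * (Real.pi : ℂ))) *
    ∫ y : ℝ, ((unvec (boundary F y))ᴴ * unvec (boundary G y)).trace

/-! ### Stable rational functions of order `r` -/

/-- The transfer function `s ↦ C (s I - A)⁻¹ B`. -/
def transfer {r m p : ℕ} (A : Matrix (Fin r) (Fin r) ℂ) (B : Matrix (Fin r) (Fin m) ℂ)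
    (C : Matrix (Fin p) (Fin r) ℂ) (s : ℂ) : Matrix (Fin p) (Fin m) ℂ :=
  C * (s • (1 : Matrix (Fin r) (Fin r) ℂ) - A)⁻¹ * B

/-- All eigenvalues lie in the open left half-plane. -/
def IsHurwitz {r : ℕ} (A : Matrix (Fin r) (Fin r) ℂ) : Prop :=
  ∀ μ ∈ spectrum ℂ A, μ.re < 0

/-- `(A, B, C)` has the least order among all realizations of its transfer function. -/
def IsMinimal {r m p : ℕ} (A : Matrix (Fin r) (Fin r) ℂ) (B : Matrix (Fin r) (Fin m) ℂ)
    (C : Matrix (Fin p) (Fin r) ℂ) : Prop :=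
  ∀ (k : ℕ) (A' : Matrix (Fin k) (Fin k) ℂ) (B' : Matrix (Fin k) (Fin m) ℂ)
    (C' : Matrix (Fin p) (Fin k) ℂ),
    (∀ s : ℂ, s ∉ spectrum ℂ A → s ∉ spectrum ℂ A' → transfer A' B' C' s = transfer A B C s) →
      r ≤ k

/-- The set `Σ⁻_{r,m,p}(ℂ)` of stable rational functions of order `r`, as functions on the
open right half-plane. -/
def StableRational (r m p : ℕ) : Set (ℂ → Matrix (Fin p) (Fin m) ℂ) :=
  {F | ∃ (A : Matrix (Fin r) (Fin r) ℂ) (B : Matrix (Fin r) (Fin m) ℂ)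
      (C : Matrix (Fin p) (Fin r) ℂ), IsHurwitz A ∧ IsMinimal A B C ∧
      ∀ s : ℂ, 0 < s.re → F s = transfer A B C s}

/-- The tangent space at `F` of `Σ⁻_{r,m,p}(ℂ)` as a submanifold of the Hardy space: the set of
velocities `γ'(0)` of the smooth curves `γ` in the Hardy space that run in `Σ⁻_{r,m,p}(ℂ)` and
pass through `F` at time `0`. Smoothness and the derivative of a curve are those with respect to
the Hardy norm, which is, up to the constant factor `(2π)^(-1/2)`, the `L²` norm of the
extension to the imaginary axis. -/
def tangentSpace (r m p : ℕ) (F : ℂ → Matrix (Fin p) (Fin m) ℂ) :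
    Set (ℂ → Matrix (Fin p) (Fin m) ℂ) :=
  {G | MemH2 G ∧ ∃ (ε : ℝ) (γ : ℝ → ℂ → Matrix (Fin p) (Fin m) ℂ), 0 < ε ∧
      (∀ t ∈ Set.Ioo (-ε) ε, γ t ∈ StableRational r m p) ∧
      ContDiffOn ℝ ∞ (fun t => boundary (γ t)) (Set.Ioo (-ε) ε) ∧
      (∀ s : ℂ, 0 < s.re → γ 0 s = F s) ∧
      HasDerivAt (fun t => boundary (γ t)) (boundary G) 0}

/-- The entrywise derivative `F'(s)` of a matrix-valued function. -/
def derivMatrix {p m : ℕ} (F : ℂ → Matrix (Fin p) (Fin m) ℂ) (s : ℂ) :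
    Matrix (Fin p) (Fin m) ℂ :=
  Matrix.of (fun i j => deriv (fun z => F z i j) s)

end H2Opt

end

noncomputable section

namespace H2Opt

open MeasureTheory Filter Topology

open scoped ContDiff Matrix ENNReal

/-! ### Holomorphic functions on vertical strips -/

section Lines

variable {E : Type*} [NormedAddCommGroup E] [NormedSpace ℂ E]

/-- A function of finite integral on the line takes small values arbitrarily far out. -/
lemma exists_lt_of_lintegral_ne_top {K : ℝ → ℝ≥0∞} (hK : ∫⁻ y, K y ≠ ⊤) (n : ℝ) {δ : ℝ≥0∞}
    (hδ : 0 < δ) : ∃ y, n < y ∧ K y < δ := by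
  by_contra! h
  apply hK
  rw [eq_top_iff]
  calc (⊤ : ℝ≥0∞) = ∫⁻ _ in Set.Ioi n, δ := by
        rw [lintegral_const, Measure.restrict_apply_univ, Real.volume_Ioi,
          ENNReal.mul_top hδ.ne']
    _ ≤ ∫⁻ y in Set.Ioi n, K y := setLIntegral_mono' measurableSet_Ioi fun y hy => h y hy
    _ ≤ ∫⁻ y, K y := setLIntegral_le_lintegral _ _

lemma re_line (x y : ℝ) : ((x : ℂ) + (y : ℂ) * Complex.I).re = x := by simp

lemma im_line (x y : ℝ) : ((x : ℂ) + (y : ℂ) * Complex.I).im = y := by simp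

lemma continuous_line_of_differentiableOn {g : ℂ → E} {S : Set ℂ} (hd : DifferentiableOn ℂ g S)
    {x : ℝ} (hx : ∀ y : ℝ, (x : ℂ) + (y : ℂ) * Complex.I ∈ S) :
    Continuous fun y : ℝ => g ((x : ℂ) + (y : ℂ) * Complex.I) :=
  hd.continuousOn.comp_continuous (by fun_prop) hx

/-- If the integrals of `‖g‖` along the vertical lines of a closed strip are uniformly bounded and
`g` is holomorphic, the integrals of `g` along the two boundary lines agree. -/
theorem integral_line_eq_of_lintegral_le [CompleteSpace E] {g : ℂ → E} {a b : ℝ} (hab : a ≤ b)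
    (hd : DifferentiableOn ℂ g {z | z.re ∈ Set.Icc a b}) {C : ℝ≥0∞} (hC : C ≠ ⊤)
    (hb : ∀ x ∈ Set.Icc a b, ∫⁻ y : ℝ, ‖g ((x : ℂ) + (y : ℂ) * Complex.I)‖ₑ ≤ C) :
    ∫ y : ℝ, g ((a : ℂ) + (y : ℂ) * Complex.I) = ∫ y : ℝ, g ((b : ℂ) + (y : ℂ) * Complex.I) := by
  have hint : ∀ x ∈ Set.Icc a b, Integrable fun y : ℝ => g ((x : ℂ) + (y : ℂ) * Complex.I) := by
    intro x hx
    refine ⟨(continuous_line_of_differentiableOn hd fun y => ?_).aestronglyMeasurable, ?_⟩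
    · simpa using hx
    · exact (hb x hx).trans_lt hC.lt_top
  set J : ℝ → ℝ≥0∞ := fun y => ∫⁻ x in Set.Icc a b, ‖g ((x : ℂ) + (y : ℂ) * Complex.I)‖ₑ with hJ
  have hmeas : AEMeasurable (Function.uncurry fun (y x : ℝ) =>
      ‖g ((x : ℂ) + (y : ℂ) * Complex.I)‖ₑ)
      ((volume : Measure ℝ).prod (volume.restrict (Set.Icc a b))) := by
    have hcont : ContinuousOn (Function.uncurry fun (y x : ℝ) =>
        g ((x : ℂ) + (y : ℂ) * Complex.I)) (Set.univ ×ˢ Set.Icc a b) := by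
      refine hd.continuousOn.comp (f := fun q : ℝ × ℝ => (q.2 : ℂ) + (q.1 : ℂ) * Complex.I)
        (by fun_prop) ?_
      rintro ⟨y, x⟩ ⟨-, hx⟩
      simpa using hx
    have := hcont.enorm.aemeasurable (μ := (volume : Measure ℝ).prod volume)
      (MeasurableSet.univ.prod measurableSet_Icc)
    rwa [← Measure.prod_restrict, Measure.restrict_univ] at this
  have hJint : ∫⁻ y, J y ≠ ⊤ := by
    rw [hJ, lintegral_lintegral_swap hmeas]
    refine ne_top_of_le_ne_top ?_ (setLIntegral_mono' measurableSet_Icc hb)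
    rw [lintegral_const, Measure.restrict_apply_univ, Real.volume_Icc]
    exact ENNReal.mul_ne_top hC ENNReal.ofReal_ne_top
  have hKint : ∫⁻ y, (J y + J (-y)) ≠ ⊤ := by
    have hJm : AEMeasurable J volume := hmeas.lintegral_prod_right'
    rw [lintegral_add_left' hJm]
    refine ENNReal.add_ne_top.2 ⟨hJint, ?_⟩
    have : ∫⁻ y, J (-y) = ∫⁻ y, J y := lintegral_neg_eq_self J
    rwa [this]
  choose T hTn hTK using fun n : ℕ =>
    exists_lt_of_lintegral_ne_top hKint (n : ℝ) (δ := ((n : ℝ≥0∞) + 1)⁻¹)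
      (ENNReal.inv_pos.2 (by finiteness))
  have hTtop : Tendsto T atTop atTop :=
    tendsto_atTop_mono (fun n => (hTn n).le) tendsto_natCast_atTop_atTop
  have hlim : ∀ x ∈ Set.Icc a b, Tendsto (fun n => ∫ y in (-T n)..T n,
      g ((x : ℂ) + (y : ℂ) * Complex.I)) atTop (𝓝 (∫ y : ℝ, g ((x : ℂ) + (y : ℂ) * Complex.I))) :=
    fun x hx => intervalIntegral_tendsto_integral (hint x hx)
      (tendsto_neg_atTop_atBot.comp hTtop) hTtop
  have hJbound : ∀ y : ℝ, ‖∫ x in a..b, g ((x : ℂ) + (y : ℂ) * Complex.I)‖ₑ ≤ J y := by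
    intro y
    rw [intervalIntegral.integral_of_le hab, ← integral_Icc_eq_integral_Ioc]
    exact enorm_integral_le_lintegral_enorm _
  have hdiff : Tendsto (fun n => Complex.I • ((∫ y in (-T n)..T n,
      g ((b : ℂ) + (y : ℂ) * Complex.I)) - ∫ y in (-T n)..T n,
      g ((a : ℂ) + (y : ℂ) * Complex.I))) atTop (𝓝 0) := by
    rw [tendsto_zero_iff_enorm_tendsto_zero]
    refine tendsto_of_tendsto_of_tendsto_of_le_of_le tendsto_const_nhds
      (h := fun n : ℕ => ((n : ℝ≥0∞) + 1)⁻¹) ?_ (fun _ => zero_le) fun n => ?_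
    · have := ENNReal.tendsto_inv_nat_nhds_zero.comp (tendsto_add_atTop_nat 1)
      refine this.congr fun n => ?_
      simp
    · have hrect := Complex.integral_boundary_rect_eq_zero_of_differentiableOn g
        ((a : ℂ) + ((-T n : ℝ) : ℂ) * Complex.I) ((b : ℂ) + (T n : ℂ) * Complex.I)
        (hd.mono fun z hz => by
          have := hz.1
          rw [Set.mem_preimage, re_line, re_line, Set.uIcc_of_le hab] at this
          exact this)
      rw [re_line, re_line, im_line, im_line] at hrect
      have heq : Complex.I • ((∫ y in (-T n)..T n,
          g ((b : ℂ) + (y : ℂ) * Complex.I)) - ∫ y in (-T n)..T n,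
          g ((a : ℂ) + (y : ℂ) * Complex.I)) =
          (∫ x in a..b, g ((x : ℂ) + (T n : ℂ) * Complex.I)) -
            ∫ x in a..b, g ((x : ℂ) + ((-T n : ℝ) : ℂ) * Complex.I) := by
        rw [smul_sub]
        rw [← sub_eq_zero, ← hrect]
        abel
      simp only [heq]
      calc _ ≤ J (T n) + J (-T n) :=
            (enorm_sub_le).trans (add_le_add (hJbound _) (hJbound _))
        _ ≤ _ := (hTK n).le
  have h0 := tendsto_nhds_unique hdiff
    (((hlim b ⟨hab, le_rfl⟩).sub (hlim a ⟨le_rfl, hab⟩)).const_smul Complex.I)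
  have := (smul_eq_zero.1 h0.symm).resolve_left Complex.I_ne_zero
  exact (sub_eq_zero.1 this).symm

end Lines

/-! ### Hardy functions on half-planes -/

section Hardy

variable {E : Type*} [NormedAddCommGroup E] [NormedSpace ℂ E]

/-- Vector-valued Hardy functions on the half-plane `a < Re z`, with a bound for the square
integrals along vertical lines. -/
structure IsHardy (a : ℝ) (f : ℂ → E) (C : ℝ) : Prop where
  differentiableOn : DifferentiableOn ℂ f {z : ℂ | a < z.re}
  memLp : ∀ x > a, MemLp (fun y : ℝ => f ((x : ℂ) + (y : ℂ) * Complex.I)) 2 volume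
  integral_le : ∀ x > a, ∫ y : ℝ, ‖f ((x : ℂ) + (y : ℂ) * Complex.I)‖ ^ 2 ≤ C

lemma aestronglyMeasurable_line {a : ℝ} {f : ℂ → E}
    (hd : DifferentiableOn ℂ f {z : ℂ | a < z.re}) {x : ℝ} (hx : a < x) :
    AEStronglyMeasurable (fun y : ℝ => f ((x : ℂ) + (y : ℂ) * Complex.I)) volume :=
  (continuous_line_of_differentiableOn hd fun y => by simpa using hx).aestronglyMeasurable

lemma IsHardy.integrable_sq {a C : ℝ} {f : ℂ → E} (hf : IsHardy a f C) {x : ℝ} (hx : a < x) :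
    Integrable fun y : ℝ => ‖f ((x : ℂ) + (y : ℂ) * Complex.I)‖ ^ 2 :=
  (hf.memLp x hx).integrable_norm_pow (by norm_num)

lemma IsHardy.mono {a a' C : ℝ} {f : ℂ → E} (hf : IsHardy a f C) (h : a ≤ a') :
    IsHardy a' f C where
  differentiableOn := hf.differentiableOn.mono fun _ hz => h.trans_lt hz
  memLp x hx := hf.memLp x (h.trans_lt hx)
  integral_le x hx := hf.integral_le x (h.trans_lt hx)

lemma IsHardy.sub {a C D : ℝ} {f g : ℂ → E} (hf : IsHardy a f C) (hg : IsHardy a g D) :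
    IsHardy a (f - g) (2 * C + 2 * D) where
  differentiableOn := hf.differentiableOn.sub hg.differentiableOn
  memLp x hx := (hf.memLp x hx).sub (hg.memLp x hx)
  integral_le x hx := by
    have h1 := (hf.integrable_sq hx).const_mul 2
    have h2 := (hg.integrable_sq hx).const_mul 2
    have h3 : Integrable fun y : ℝ => ‖(f - g) ((x : ℂ) + (y : ℂ) * Complex.I)‖ ^ 2 :=
      ((hf.memLp x hx).sub (hg.memLp x hx)).integrable_norm_pow (by norm_num)
    calc _ ≤ ∫ y : ℝ, (2 * ‖f ((x : ℂ) + (y : ℂ) * Complex.I)‖ ^ 2 +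
          2 * ‖g ((x : ℂ) + (y : ℂ) * Complex.I)‖ ^ 2) := by
          refine integral_mono h3 (h1.add h2) fun y => ?_
          have := norm_sub_le (f ((x : ℂ) + (y : ℂ) * Complex.I))
            (g ((x : ℂ) + (y : ℂ) * Complex.I))
          simp only [Pi.sub_apply]
          nlinarith [sq_nonneg (‖f ((x : ℂ) + (y : ℂ) * Complex.I)‖ -
            ‖g ((x : ℂ) + (y : ℂ) * Complex.I)‖),
            norm_nonneg (f ((x : ℂ) + (y : ℂ) * Complex.I) -
              g ((x : ℂ) + (y : ℂ) * Complex.I))]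
      _ ≤ 2 * C + 2 * D := by
          rw [integral_add h1 h2, integral_const_mul, integral_const_mul]
          linarith [hf.integral_le x hx, hg.integral_le x hx]

lemma cauchyKernel_eq {d : ℝ} (hd : 0 < d) (t y : ℝ) :
    (d ^ 2 + (y - t) ^ 2)⁻¹ = (d ^ 2)⁻¹ * (1 + ((y - t) / d) ^ 2)⁻¹ := by
  rw [← mul_inv]
  congr 1
  field_simp

lemma integrable_cauchyKernel {d : ℝ} (hd : 0 < d) (t : ℝ) :
    Integrable fun y : ℝ => (d ^ 2 + (y - t) ^ 2)⁻¹ := by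
  simp_rw [cauchyKernel_eq hd]
  exact ((integrable_inv_one_add_sq.comp_div hd.ne').comp_sub_right t).const_mul _

lemma integral_cauchyKernel {d : ℝ} (hd : 0 < d) (t : ℝ) :
    ∫ y : ℝ, (d ^ 2 + (y - t) ^ 2)⁻¹ = Real.pi / d := by
  simp_rw [cauchyKernel_eq hd]
  rw [integral_const_mul,
    integral_sub_right_eq_self (fun y : ℝ => (1 + (y / d) ^ 2)⁻¹) t,
    Measure.integral_comp_div (fun y : ℝ => (1 + y ^ 2)⁻¹) d, integral_univ_inv_one_add_sq,
    abs_of_pos hd, smul_eq_mul]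
  field_simp

lemma normSq_line_sub (x y : ℝ) (ρ : ℂ) :
    ‖(x : ℂ) + (y : ℂ) * Complex.I - ρ‖ ^ 2 = (x - ρ.re) ^ 2 + (y - ρ.im) ^ 2 := by
  rw [← Complex.normSq_eq_norm_sq, Complex.normSq_apply]
  simp
  ring

lemma norm_line_sub_inv_sq_le {d x : ℝ} {ρ : ℂ} (hd : 0 < d) (hx : d ≤ x - ρ.re) (y : ℝ) :
    ‖((x : ℂ) + (y : ℂ) * Complex.I - ρ)⁻¹‖ ^ 2 ≤ (d ^ 2 + (y - ρ.im) ^ 2)⁻¹ := by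
  rw [norm_inv, inv_pow, normSq_line_sub]
  gcongr

/-- Holomorphic functions that decay like `1 / z` belong to the Hardy space. -/
lemma IsHardy.of_norm_le {a K : ℝ} {ρ : ℂ} {f : ℂ → E} (hρ : ρ.re < a)
    (hd : DifferentiableOn ℂ f {z : ℂ | a < z.re})
    (hK : ∀ z : ℂ, a < z.re → ‖f z‖ ≤ K * ‖(z - ρ)⁻¹‖) :
    IsHardy a f (K ^ 2 * (Real.pi / (a - ρ.re))) := by
  have hda : 0 < a - ρ.re := sub_pos.2 hρ
  have key : ∀ x > a, ∀ y : ℝ, ‖f ((x : ℂ) + (y : ℂ) * Complex.I)‖ ^ 2 ≤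
      K ^ 2 * ((a - ρ.re) ^ 2 + (y - ρ.im) ^ 2)⁻¹ := by
    intro x hx y
    have h1 := hK ((x : ℂ) + (y : ℂ) * Complex.I) (by simpa using hx)
    have h2 := norm_line_sub_inv_sq_le hda (ρ := ρ) (x := x) (by linarith) y
    calc _ ≤ (K * ‖((x : ℂ) + (y : ℂ) * Complex.I - ρ)⁻¹‖) ^ 2 := by gcongr
      _ = K ^ 2 * ‖((x : ℂ) + (y : ℂ) * Complex.I - ρ)⁻¹‖ ^ 2 := mul_pow _ _ _
      _ ≤ _ := by gcongr
  have hint := (integrable_cauchyKernel hda ρ.im).const_mul (K ^ 2)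
  have hsq : ∀ x > a, Integrable fun y : ℝ => ‖f ((x : ℂ) + (y : ℂ) * Complex.I)‖ ^ 2 := by
    intro x hx
    refine hint.mono' ((aestronglyMeasurable_line hd hx).norm.pow 2) (ae_of_all _ fun y => ?_)
    rw [Real.norm_of_nonneg (by positivity)]
    exact key x hx y
  refine ⟨hd, fun x hx => ?_, fun x hx => ?_⟩
  · rw [memLp_two_iff_integrable_sq_norm (aestronglyMeasurable_line hd hx)]
    exact hsq x hx
  · calc _ ≤ ∫ y : ℝ, K ^ 2 * ((a - ρ.re) ^ 2 + (y - ρ.im) ^ 2)⁻¹ :=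
          integral_mono (hsq x hx) hint (key x hx)
      _ = _ := by rw [integral_const_mul, integral_cauchyKernel hda]

lemma differentiableOn_inv_sub_smul {a : ℝ} {ρ : ℂ} (hρ : ρ.re < a) (w : E) :
    DifferentiableOn ℂ (fun z => (z - ρ)⁻¹ • w) {z : ℂ | a < z.re} := by
  intro z hz
  have : z - ρ ≠ 0 := by
    intro h
    rw [sub_eq_zero.1 h] at hz
    exact absurd hz (not_lt.2 hρ.le)
  exact (((differentiableAt_id.sub_const ρ).inv this).smul_const w).differentiableWithinAt

lemma isHardy_inv_sub_smul {a : ℝ} {ρ : ℂ} (hρ : ρ.re < a) (w : E) :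
    IsHardy a (fun z => (z - ρ)⁻¹ • w) (‖w‖ ^ 2 * (Real.pi / (a - ρ.re))) :=
  IsHardy.of_norm_le hρ (differentiableOn_inv_sub_smul hρ w) fun z _ => by
    rw [norm_smul, mul_comm]

lemma norm_inv_le_of_re {d : ℝ} (hd : 0 < d) {w : ℂ} (hw : d ≤ w.re) : ‖w⁻¹‖ ≤ d⁻¹ := by
  rw [norm_inv]
  exact inv_anti₀ hd (hw.trans (Complex.re_le_norm w))

lemma norm_le_sq_add_sq {u v : ℝ} (δ : ℝ) (hδ : 0 < δ) : u * v ≤ δ * u ^ 2 + δ⁻¹ * v ^ 2 := by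
  have h := sq_nonneg (δ * u - v)
  have : δ⁻¹ * (δ * u - v) ^ 2 = δ * u ^ 2 + δ⁻¹ * v ^ 2 - 2 * (u * v) := by
    field_simp
    ring
  have h2 : 0 ≤ δ⁻¹ * (δ * u - v) ^ 2 := by positivity
  nlinarith [mul_nonneg hδ.le (sq_nonneg u), mul_nonneg (inv_nonneg.2 hδ.le) (sq_nonneg v)]

/-- A Hardy function that vanishes at `s`, divided by `z - s`, has integral zero over every
vertical line to the left of `s`. -/
lemma IsHardy.integral_dslope_eq_zero [CompleteSpace E] {a C x₀ : ℝ} {G : ℂ → E} {s : ℂ}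
    (hG : IsHardy a G C) (hGs : G s = 0) (hax : a < x₀) (hxs : x₀ < s.re) :
    ∫ y : ℝ, dslope G s ((x₀ : ℂ) + (y : ℂ) * Complex.I) = 0 := by
  set g := dslope G s with hg
  have hopen : IsOpen {z : ℂ | a < z.re} := isOpen_lt continuous_const Complex.continuous_re
  have hgd : DifferentiableOn ℂ g {z : ℂ | a < z.re} :=
    (Complex.differentiableOn_dslope (hopen.mem_nhds (hax.trans hxs))).2 hG.differentiableOn
  have hgn : ∀ z, z ≠ s → ‖g z‖ = ‖G z‖ * ‖(z - s)⁻¹‖ := by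
    intro z hz
    rw [hg, dslope_of_ne _ hz, slope_def_module, hGs, sub_zero, norm_smul, mul_comm]
  have hshift : ∀ X, x₀ ≤ X → ∫ y : ℝ, g ((x₀ : ℂ) + (y : ℂ) * Complex.I) =
      ∫ y : ℝ, g ((X : ℂ) + (y : ℂ) * Complex.I) := by
    intro X hX
    have hsub : Set.Icc x₀ X ×ℂ Set.Icc (s.im - 1) (s.im + 1) ⊆ {z : ℂ | a < z.re} :=
      fun z hz => hax.trans_le hz.1.1
    obtain ⟨K, hK⟩ := (isCompact_Icc.reProdIm isCompact_Icc).exists_bound_of_continuousOn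
      (hgd.continuousOn.mono hsub)
    have hpt : ∀ x ∈ Set.Icc x₀ X, ∀ y : ℝ, ‖g ((x : ℂ) + (y : ℂ) * Complex.I)‖ ≤
        ‖G ((x : ℂ) + (y : ℂ) * Complex.I)‖ ^ 2 +
          (2 * |K| + 2) * (1 ^ 2 + (y - s.im) ^ 2)⁻¹ := by
      intro x hx y
      by_cases hy : |y - s.im| ≤ 1
      · have h1 := hK ((x : ℂ) + (y : ℂ) * Complex.I) (by
          rw [Complex.mem_reProdIm, re_line, im_line]
          rw [abs_le] at hy
          exact ⟨hx, by linarith [hy.1], by linarith [hy.2]⟩)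
        have h2 : (1 : ℝ) / 2 ≤ (1 ^ 2 + (y - s.im) ^ 2)⁻¹ := by
          rw [one_div]
          refine inv_anti₀ (by positivity) ?_
          nlinarith [sq_abs (y - s.im), abs_nonneg (y - s.im)]
        nlinarith [le_abs_self K, abs_nonneg K,
          sq_nonneg ‖G ((x : ℂ) + (y : ℂ) * Complex.I)‖]
      · push Not at hy
        have hne : (x : ℂ) + (y : ℂ) * Complex.I ≠ s := by
          rintro rfl
          simp at hy
          linarith
        rw [hgn _ hne]
        have h1 := norm_le_sq_add_sq (u := ‖G ((x : ℂ) + (y : ℂ) * Complex.I)‖)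
          (v := ‖((x : ℂ) + (y : ℂ) * Complex.I - s)⁻¹‖) 1 one_pos
        have hy2 : 1 < (y - s.im) ^ 2 := by
          rw [← sq_abs]
          nlinarith
        have h2 : ‖((x : ℂ) + (y : ℂ) * Complex.I - s)⁻¹‖ ^ 2 ≤
            2 * (1 ^ 2 + (y - s.im) ^ 2)⁻¹ := by
          rw [norm_inv, inv_pow, normSq_line_sub, ← div_eq_mul_inv, inv_le_comm₀, inv_div,
            div_le_iff₀]
          · nlinarith [sq_nonneg (x - s.re)]
          · norm_num
          · nlinarith [sq_nonneg (x - s.re)]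
          · positivity
        have h3 : 0 ≤ 2 * |K| * (1 ^ 2 + (y - s.im) ^ 2)⁻¹ := by positivity
        linarith
    have hdom := (integrable_cauchyKernel one_pos s.im).const_mul (2 * |K| + 2)
    refine integral_line_eq_of_lintegral_le hX (hgd.mono fun z hz => hax.trans_le hz.1)
      (C := ENNReal.ofReal (C + (2 * |K| + 2) * (Real.pi / 1))) ENNReal.ofReal_ne_top ?_
    intro x hx
    have hax' := hax.trans_le hx.1
    have hi := (hG.integrable_sq hax').add hdom
    calc ∫⁻ y : ℝ, ‖g ((x : ℂ) + (y : ℂ) * Complex.I)‖ₑ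
        ≤ ∫⁻ y : ℝ, ENNReal.ofReal (‖G ((x : ℂ) + (y : ℂ) * Complex.I)‖ ^ 2 +
          (2 * |K| + 2) * (1 ^ 2 + (y - s.im) ^ 2)⁻¹) := by
          refine lintegral_mono fun y => ?_
          rw [← ofReal_norm]
          exact ENNReal.ofReal_le_ofReal (hpt x hx y)
      _ = ENNReal.ofReal (∫ y : ℝ, (‖G ((x : ℂ) + (y : ℂ) * Complex.I)‖ ^ 2 +
          (2 * |K| + 2) * (1 ^ 2 + (y - s.im) ^ 2)⁻¹)) :=
          (ofReal_integral_eq_lintegral_ofReal hi (ae_of_all _ fun y => by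
            simp only [Pi.zero_apply, Pi.add_apply]; positivity)).symm
      _ ≤ _ := by
          refine ENNReal.ofReal_le_ofReal ?_
          rw [integral_add (hG.integrable_sq hax') hdom, integral_const_mul,
            integral_cauchyKernel one_pos]
          linarith [hG.integral_le x hax']
  have hC : 0 ≤ C := (integral_nonneg fun y => by positivity).trans (hG.integral_le x₀ hax)
  have hbound : ∀ δ > 0, ‖∫ y : ℝ, g ((x₀ : ℂ) + (y : ℂ) * Complex.I)‖ ≤ δ * (C + Real.pi) := by
    intro δ hδ
    set e : ℝ := (δ ^ 2)⁻¹ with he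
    have he0 : 0 < e := by positivity
    have hXa : a < s.re + e := by linarith
    rw [hshift (s.re + e) (by linarith)]
    have hker : ∀ y : ℝ, ‖(((s.re + e : ℝ) : ℂ) + (y : ℂ) * Complex.I - s)⁻¹‖ ^ 2 =
        (e ^ 2 + (y - s.im) ^ 2)⁻¹ := by
      intro y
      rw [norm_inv, inv_pow, normSq_line_sub, add_sub_cancel_left]
    have hi := ((hG.integrable_sq hXa).const_mul δ).add
      ((integrable_cauchyKernel he0 s.im).const_mul δ⁻¹)
    calc _ ≤ ∫ y : ℝ, (δ * ‖G (((s.re + e : ℝ) : ℂ) + (y : ℂ) * Complex.I)‖ ^ 2 +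
          δ⁻¹ * (e ^ 2 + (y - s.im) ^ 2)⁻¹) := by
          refine norm_integral_le_of_norm_le hi (ae_of_all _ fun y => ?_)
          rw [hgn _ (by
            intro h
            have := congrArg Complex.re h
            rw [re_line] at this
            linarith)]
          rw [← hker y]
          exact norm_le_sq_add_sq δ hδ
      _ ≤ δ * (C + Real.pi) := by
          rw [integral_add ((hG.integrable_sq hXa).const_mul δ)
            ((integrable_cauchyKernel he0 s.im).const_mul δ⁻¹), integral_const_mul,
            integral_const_mul, integral_cauchyKernel he0]
          have h1 := mul_le_mul_of_nonneg_left (hG.integral_le _ hXa) hδ.le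
          have h2 : δ⁻¹ * (Real.pi / e) = δ * Real.pi := by
            rw [he]; field_simp
          linarith
  have : ‖∫ y : ℝ, g ((x₀ : ℂ) + (y : ℂ) * Complex.I)‖ ≤ 0 := by
    refine le_of_forall_pos_le_add fun η hη => ?_
    have hp : 0 < C + Real.pi := by linarith [Real.pi_pos]
    have := hbound (η / (C + Real.pi)) (by positivity)
    rwa [div_mul_cancel₀ _ hp.ne', ← zero_add η] at this
  exact norm_le_zero_iff.1 this

lemma IsHardy.integrable_inv_sub_smul {a C x₀ : ℝ} {f : ℂ → E} {s : ℂ}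
    (hf : IsHardy a f C) (hax : a < x₀) (hxs : x₀ < s.re) :
    Integrable fun y : ℝ => (s - ((x₀ : ℂ) + (y : ℂ) * Complex.I))⁻¹ •
      f ((x₀ : ℂ) + (y : ℂ) * Complex.I) := by
  have hne : ∀ y : ℝ, (x₀ : ℂ) + (y : ℂ) * Complex.I ≠ s := by
    intro y h
    have := congrArg Complex.re h
    rw [re_line] at this
    linarith
  have hdom := (hf.integrable_sq hax).add (integrable_cauchyKernel (sub_pos.2 hxs) s.im)
  refine hdom.mono' ?_ (ae_of_all _ fun y => ?_)
  · refine AEStronglyMeasurable.smul ?_ (hf.memLp x₀ hax).1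
    refine Continuous.aestronglyMeasurable (Continuous.inv₀ (by fun_prop) fun y => ?_)
    exact sub_ne_zero.2 (hne y).symm
  · have h1 := norm_le_sq_add_sq (u := ‖f ((x₀ : ℂ) + (y : ℂ) * Complex.I)‖)
      (v := ‖(s - ((x₀ : ℂ) + (y : ℂ) * Complex.I))⁻¹‖) 1 one_pos
    have h2 : ‖(s - ((x₀ : ℂ) + (y : ℂ) * Complex.I))⁻¹‖ ^ 2 =
        ((s.re - x₀) ^ 2 + (y - s.im) ^ 2)⁻¹ := by
      rw [norm_inv, norm_sub_rev, inv_pow, normSq_line_sub]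
      ring_nf
    rw [norm_smul, Pi.add_apply, mul_comm]
    linarith

/-- Cauchy's formula on a half-plane. -/
theorem IsHardy.integral_inv_sub_smul [CompleteSpace E] {a C x₀ : ℝ} {f : ℂ → E} {s : ℂ}
    (hf : IsHardy a f C) (hax : a < x₀) (hxs : x₀ < s.re) :
    ∫ y : ℝ, (s - ((x₀ : ℂ) + (y : ℂ) * Complex.I))⁻¹ • f ((x₀ : ℂ) + (y : ℂ) * Complex.I) =
      (2 * Real.pi : ℂ) • f s := by
  set σ : ℝ := s.re - x₀ with hσ
  have hσ0 : 0 < σ := sub_pos.2 hxs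
  set ρ : ℂ := ((x₀ - σ : ℝ) : ℂ) + (s.im : ℂ) * Complex.I with hρ
  have hρre : ρ.re = x₀ - σ := re_line _ _
  have hρim : ρ.im = s.im := im_line _ _
  set a' := max a (x₀ - σ / 2) with ha'
  have ha'x : a' < x₀ := max_lt hax (by linarith)
  have hρa' : ρ.re < a' := lt_of_lt_of_le (by rw [hρre]; linarith) (le_max_right _ _)
  set w : E := (2 * σ : ℂ) • f s with hw
  have hsρ : s - ρ = (2 * σ : ℂ) := by
    apply Complex.ext
    · rw [Complex.sub_re, hρre]; simp [hσ]; ring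
    · rw [Complex.sub_im, hρim]; simp
  have hσc : (2 * σ : ℂ) ≠ 0 := by exact_mod_cast (by positivity : 2 * σ ≠ 0)
  have hG := (hf.mono (le_max_left a (x₀ - σ / 2))).sub (isHardy_inv_sub_smul hρa' w)
  have hGs : (f - fun z => (z - ρ)⁻¹ • w) s = 0 := by
    simp only [Pi.sub_apply, hsρ, hw]
    rw [smul_smul, inv_mul_cancel₀ hσc, one_smul, sub_self]
  have h0 := hG.integral_dslope_eq_zero hGs ha'x hxs
  have hker : ∀ y : ℝ, ((x₀ : ℂ) + (y : ℂ) * Complex.I - s)⁻¹ *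
      ((x₀ : ℂ) + (y : ℂ) * Complex.I - ρ)⁻¹ = -(((σ ^ 2 + (y - s.im) ^ 2)⁻¹ : ℝ) : ℂ) := by
    intro y
    rw [← mul_inv, Complex.ofReal_inv, ← inv_neg]
    congr 1
    have hI : Complex.I * Complex.I = -1 := Complex.I_mul_I
    have h1 : (x₀ : ℂ) + (y : ℂ) * Complex.I - s = -(σ : ℂ) + ((y - s.im : ℝ) : ℂ) * Complex.I := by
      apply Complex.ext <;> simp [hσ]
    have h2 : (x₀ : ℂ) + (y : ℂ) * Complex.I - ρ = (σ : ℂ) + ((y - s.im : ℝ) : ℂ) * Complex.I := by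
      rw [hρ]
      apply Complex.ext <;> simp
    rw [h1, h2]
    push_cast
    linear_combination ((y : ℂ) - s.im) ^ 2 * hI
  have hne : ∀ y : ℝ, (x₀ : ℂ) + (y : ℂ) * Complex.I ≠ s := by
    intro y h
    have := congrArg Complex.re h
    rw [re_line] at this
    linarith
  have hds : ∀ y : ℝ, dslope (f - fun z => (z - ρ)⁻¹ • w) s ((x₀ : ℂ) + (y : ℂ) * Complex.I) =
      (((σ ^ 2 + (y - s.im) ^ 2)⁻¹ : ℝ) : ℂ) • w -
        (s - ((x₀ : ℂ) + (y : ℂ) * Complex.I))⁻¹ • f ((x₀ : ℂ) + (y : ℂ) * Complex.I) := by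
    intro y
    rw [dslope_of_ne _ (hne y), slope_def_module, hGs, sub_zero, Pi.sub_apply, smul_sub,
      smul_smul, hker y, neg_smul, sub_neg_eq_add, add_comm, ← neg_sub s, inv_neg,
      neg_smul, ← sub_eq_add_neg]
  simp_rw [hds] at h0
  have hint1 : Integrable fun y : ℝ => (((σ ^ 2 + (y - s.im) ^ 2)⁻¹ : ℝ) : ℂ) • w :=
    ((integrable_cauchyKernel hσ0 s.im).ofReal).smul_const w
  have hint2 := hf.integrable_inv_sub_smul hax hxs
  rw [integral_sub hint1 hint2, integral_smul_const, integral_complex_ofReal,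
    integral_cauchyKernel hσ0] at h0
  rw [← sub_eq_zero.1 h0, hw, smul_smul]
  congr 1
  have : (σ : ℂ) ≠ 0 := by exact_mod_cast hσ0.ne'
  push_cast
  field_simp

end Hardy

/-! ### Boundary values -/

section Boundary

/-- A bounded midpoint convex function on the positive half-line is nonincreasing. -/
lemma antitoneOn_of_midpoint_le {Φ : ℝ → ℝ} {C : ℝ} (hC : ∀ t > 0, Φ t ≤ C)
    (hΦ : ∀ s > 0, ∀ t > 0, 2 * Φ ((s + t) / 2) ≤ Φ s + Φ t) : AntitoneOn Φ (Set.Ioi 0) := by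
  intro s hs t ht hst
  rw [Set.mem_Ioi] at hs ht
  by_contra! hlt
  have hd : 0 ≤ t - s := sub_nonneg.2 hst
  have key : ∀ n : ℕ, Φ t - Φ s ≤ Φ (t + (n * (t - s))) - Φ (s + n * (t - s)) := by
    intro n
    induction n with
    | zero => simp
    | succ n ih =>
      have hp : 0 ≤ (n : ℝ) * (t - s) := by positivity
      have h := hΦ (s + n * (t - s)) (by linarith) (s + (n + 1 + 1) * (t - s)) (by nlinarith)
      have e1 : (s + n * (t - s) + (s + (n + 1 + 1) * (t - s))) / 2 = t + n * (t - s) := by ring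
      rw [e1] at h
      have e2 : t + ((n + 1 : ℕ) : ℝ) * (t - s) = s + (n + 1 + 1) * (t - s) := by push_cast; ring
      have e3 : s + ((n + 1 : ℕ) : ℝ) * (t - s) = t + n * (t - s) := by push_cast; ring
      rw [e2, e3]
      linarith
  have key2 : ∀ n : ℕ, n * (Φ t - Φ s) ≤ Φ (s + n * (t - s)) - Φ s := by
    intro n
    induction n with
    | zero => simp
    | succ n ih =>
      have e3 : s + ((n + 1 : ℕ) : ℝ) * (t - s) = t + n * (t - s) := by push_cast; ring
      rw [e3]
      push_cast
      linarith [key n]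
  obtain ⟨n, hn⟩ := exists_nat_gt ((C - Φ s) / (Φ t - Φ s))
  rw [div_lt_iff₀ (by linarith)] at hn
  have hp : 0 ≤ (n : ℝ) * (t - s) := by positivity
  linarith [key2 n, hC (s + n * (t - s)) (by linarith)]

/-- A bounded family of vectors with the property that `⟪S x, S y⟫` depends on `x + y` only
converges at `0`. -/
lemma exists_tendsto_of_inner_eq {L : Type*} [NormedAddCommGroup L] [InnerProductSpace ℂ L]
    [CompleteSpace L] {S : ℝ → L} {C : ℝ} (hC : ∀ x > 0, ‖S x‖ ^ 2 ≤ C)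
    (hS : ∀ x > 0, ∀ y > 0, inner ℂ (S x) (S y) = inner ℂ (S ((x + y) / 2)) (S ((x + y) / 2))) :
    ∃ l, Tendsto S (𝓝[>] 0) (𝓝 l) := by
  set Φ : ℝ → ℝ := fun t => ‖S t‖ ^ 2 with hΦ
  have hsub : ∀ x > 0, ∀ y > 0, ‖S x - S y‖ ^ 2 = Φ x + Φ y - 2 * Φ ((x + y) / 2) := by
    intro x hx y hy
    have h1 := norm_sub_sq (𝕜 := ℂ) (S x) (S y)
    have h2 : RCLike.re (inner ℂ (S x) (S y)) = Φ ((x + y) / 2) := by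
      rw [hS x hx y hy, inner_self_eq_norm_sq]
    rw [h1, h2]
    simp only [hΦ]
    ring
  have hanti : AntitoneOn Φ (Set.Ioi 0) := by
    refine antitoneOn_of_midpoint_le hC fun s hs t ht => ?_
    have := hsub s hs t ht
    nlinarith [sq_nonneg ‖S s - S t‖]
  obtain ⟨M, hM⟩ : ∃ M, Tendsto Φ (𝓝[>] 0) (𝓝 M) := by
    refine ⟨_, hanti.tendsto_nhdsGT ?_⟩
    refine ⟨C, ?_⟩
    rintro _ ⟨x, hx, rfl⟩
    exact hC x hx
  have hcauchy : Cauchy (map S (𝓝[>] 0)) := by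
    rw [Metric.cauchy_iff]
    refine ⟨inferInstance, fun ε hε => ?_⟩
    have hev : ∀ᶠ x in 𝓝[>] (0 : ℝ), Φ x ∈ Metric.ball M (ε ^ 2 / 8) :=
      hM (Metric.ball_mem_nhds M (by positivity))
    obtain ⟨η, hη, hball⟩ := mem_nhdsGT_iff_exists_Ioo_subset.1 hev
    rw [Set.mem_Ioi] at hη
    have hb : ∀ x ∈ Set.Ioo 0 η, |Φ x - M| < ε ^ 2 / 8 := fun x hx => by
      simpa [Real.dist_eq] using hball hx
    refine ⟨S '' Set.Ioo 0 η, image_mem_map (Ioo_mem_nhdsGT hη), ?_⟩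
    rintro _ ⟨x, hx, rfl⟩ _ ⟨y, hy, rfl⟩
    rw [dist_eq_norm]
    refine lt_of_pow_lt_pow_left₀ 2 hε.le ?_
    rw [hsub x hx.1 y hy.1]
    have h1 := abs_lt.1 (hb x hx)
    have h2 := abs_lt.1 (hb y hy)
    have h3 := abs_lt.1 (hb ((x + y) / 2) ⟨by linarith [hx.1, hy.1], by linarith [hx.2, hy.2]⟩)
    nlinarith [h1.2, h2.2, h3.1, sq_pos_of_pos hε]
  exact CompleteSpace.complete hcauchy

variable {ι : Type*} [Fintype ι]

/-- For a Hardy function `f`, the inner product of its restrictions to the lines `Re z = x` and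
`Re z = y` depends on `x + y` only. -/
lemma IsHardy.integral_inner_eq {C : ℝ} {f : ℂ → EuclideanSpace ℂ ι} (hf : IsHardy 0 f C)
    {x x' y y' : ℝ} (hx' : 0 < x') (hy : 0 < y) (hyy : y ≤ y') (hsum : x + y = x' + y') :
    ∫ t : ℝ, inner ℂ (f ((x : ℂ) + (t : ℂ) * Complex.I)) (f ((y : ℂ) + (t : ℂ) * Complex.I)) =
    ∫ t : ℝ, inner ℂ (f ((x' : ℂ) + (t : ℂ) * Complex.I))
      (f ((y' : ℂ) + (t : ℂ) * Complex.I)) := by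
  set c : ℝ := x + y with hc
  set g : ℂ → ℂ := fun z => inner ℂ (f ((c : ℂ) - star z)) (f z) with hg
  have hrefl : ∀ u t : ℝ, (c : ℂ) - star ((u : ℂ) + (t : ℂ) * Complex.I) =
      ((c - u : ℝ) : ℂ) + (t : ℂ) * Complex.I := by
    intro u t
    apply Complex.ext <;> simp
  have hgline : ∀ u t : ℝ, g ((u : ℂ) + (t : ℂ) * Complex.I) =
      inner ℂ (f (((c - u : ℝ) : ℂ) + (t : ℂ) * Complex.I)) (f ((u : ℂ) + (t : ℂ) * Complex.I)) := by
    intro u t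
    simp only [hg, hrefl]
  have hopen : IsOpen {z : ℂ | 0 < z.re} := isOpen_lt continuous_const Complex.continuous_re
  have hcoord : ∀ i, ∀ z : ℂ, 0 < z.re → DifferentiableAt ℂ (fun z => f z i) z := by
    intro i z hz
    exact (EuclideanSpace.proj (𝕜 := ℂ) i).differentiableAt.comp z
      (hf.differentiableOn.differentiableAt (hopen.mem_nhds hz))
  have hgd : DifferentiableOn ℂ g {z | z.re ∈ Set.Icc y y'} := by
    intro z hz
    refine DifferentiableAt.differentiableWithinAt ?_
    have hz0 : 0 < z.re := hy.trans_le hz.1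
    have hcz : 0 < ((c : ℂ) - star z).re := by
      have := hz.2
      simp
      linarith
    have hsumeq : g = fun z => ∑ i, f z i * star (f ((c : ℂ) - star z) i) := by
      funext z
      simp only [hg, PiLp.inner_apply, RCLike.inner_apply]
      rfl
    rw [hsumeq]
    refine DifferentiableAt.fun_sum fun i _ => (hcoord i z hz0).mul ?_
    have h1 : DifferentiableAt ℂ (fun w => f ((c : ℂ) - w) i) (star z) :=
      (hcoord i _ hcz).comp (star z) (differentiableAt_id.const_sub (c : ℂ))
    have h2 := h1.star_star
    rw [star_star] at h2
    exact h2
  have hsq := fun u (hu : 0 < u) => hf.integrable_sq hu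
  have key := integral_line_eq_of_lintegral_le hyy hgd (C := ENNReal.ofReal (C + C))
    ENNReal.ofReal_ne_top ?_
  · simp_rw [hgline] at key
    have e1 : c - y = x := by rw [hc]; ring
    have e2 : c - y' = x' := by linarith
    rwa [e1, e2] at key
  · intro u hu
    have hu0 : 0 < u := hy.trans_le hu.1
    have hcu : 0 < c - u := by linarith [hu.2]
    have hi := (hsq (c - u) hcu).add (hsq u hu0)
    calc ∫⁻ t : ℝ, ‖g ((u : ℂ) + (t : ℂ) * Complex.I)‖ₑ
        ≤ ∫⁻ t : ℝ, ENNReal.ofReal (‖f (((c - u : ℝ) : ℂ) + (t : ℂ) * Complex.I)‖ ^ 2 +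
          ‖f ((u : ℂ) + (t : ℂ) * Complex.I)‖ ^ 2) := by
          refine lintegral_mono fun t => ?_
          rw [← ofReal_norm, hgline]
          refine ENNReal.ofReal_le_ofReal ((norm_inner_le_norm _ _).trans ?_)
          have := norm_le_sq_add_sq (u := ‖f (((c - u : ℝ) : ℂ) + (t : ℂ) * Complex.I)‖)
            (v := ‖f ((u : ℂ) + (t : ℂ) * Complex.I)‖) 1 one_pos
          linarith
      _ = ENNReal.ofReal (∫ t : ℝ, (‖f (((c - u : ℝ) : ℂ) + (t : ℂ) * Complex.I)‖ ^ 2 +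
          ‖f ((u : ℂ) + (t : ℂ) * Complex.I)‖ ^ 2)) :=
          (ofReal_integral_eq_lintegral_ofReal hi (ae_of_all _ fun y => by
            simp only [Pi.zero_apply, Pi.add_apply]; positivity)).symm
      _ ≤ _ := by
          refine ENNReal.ofReal_le_ofReal ?_
          rw [integral_add (hsq (c - u) hcu) (hsq u hu0)]
          linarith [hf.integral_le u hu0, hf.integral_le _ hcu]

variable {p m : ℕ}

lemma vec_apply (M : Matrix (Fin p) (Fin m) ℂ) (ij : Fin p × Fin m) :
    vec M ij = M ij.1 ij.2 := rfl

lemma differentiableOn_vec {F : ℂ → Matrix (Fin p) (Fin m) ℂ} {S : Set ℂ} :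
    DifferentiableOn ℂ (fun s => vec (F s)) S ↔ ∀ i j, DifferentiableOn ℂ (fun s => F s i j) S := by
  rw [differentiableOn_euclidean]
  exact ⟨fun h i j => h (i, j), fun h ij => h ij.1 ij.2⟩

/-- Membership in the Hardy space in terms of the vector-valued function `vec ∘ F`. -/
lemma memH2_iff {F : ℂ → Matrix (Fin p) (Fin m) ℂ} :
    MemH2 F ↔ ∃ C, IsHardy 0 (fun s => vec (F s)) C := by
  have hsq : ∀ v : FrobSpace p m, ‖v‖ₑ ^ 2 = ENNReal.ofReal (‖v‖ ^ 2) := fun v => by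
    rw [← ofReal_norm, ENNReal.ofReal_pow (norm_nonneg v)]
  constructor
  · intro h
    have hd := differentiableOn_vec.2 h.analytic
    set B := ⨆ ξ ∈ Set.Ioi (0 : ℝ), ∫⁻ y : ℝ, ‖slice F ξ y‖ₑ ^ 2 with hB
    have hle : ∀ x > 0, ∫⁻ y : ℝ, ‖slice F x y‖ₑ ^ 2 ≤ B := fun x hx =>
      le_iSup₂ (f := fun ξ (_ : ξ ∈ Set.Ioi (0 : ℝ)) => ∫⁻ y : ℝ, ‖slice F ξ y‖ₑ ^ 2) x hx
    have hint : ∀ x > 0, Integrable fun y : ℝ => ‖slice F x y‖ ^ 2 := by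
      intro x hx
      refine ⟨(aestronglyMeasurable_line hd hx).norm.pow 2, ?_⟩
      refine lt_of_le_of_lt ?_ ((hle x hx).trans_lt h.bounded)
      refine lintegral_mono fun y => ?_
      rw [hsq, ← ofReal_norm, Real.norm_of_nonneg (by positivity)]
    refine ⟨B.toReal, hd, fun x hx => ?_, fun x hx => ?_⟩
    · exact (memLp_two_iff_integrable_sq_norm (aestronglyMeasurable_line hd hx)).2 (hint x hx)
    · have h1 := ofReal_integral_eq_lintegral_ofReal (hint x hx)
        (ae_of_all _ fun y => by simp only [Pi.zero_apply]; positivity)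
      simp_rw [← hsq] at h1
      have h2 := hle x hx
      rw [← h1] at h2
      exact (ENNReal.ofReal_le_iff_le_toReal h.bounded.ne).1 h2
  · rintro ⟨C, hC⟩
    refine ⟨differentiableOn_vec.1 hC.differentiableOn, ?_⟩
    refine lt_of_le_of_lt (iSup₂_le fun x hx => ?_) (ENNReal.ofReal_lt_top (r := C))
    simp_rw [hsq]
    refine (ofReal_integral_eq_lintegral_ofReal (hC.integrable_sq hx)
      (ae_of_all _ fun y => by simp only [Pi.zero_apply]; positivity)).symm.trans_le ?_
    exact ENNReal.ofReal_le_ofReal (hC.integral_le x hx)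

lemma MemH2.memLp {F : ℂ → Matrix (Fin p) (Fin m) ℂ} (hF : MemH2 F) {x : ℝ} (hx : 0 < x) :
    MemLp (slice F x) 2 volume := by
  obtain ⟨C, hC⟩ := memH2_iff.1 hF
  exact hC.memLp x hx

lemma MemH2.sliceLp_eq {F : ℂ → Matrix (Fin p) (Fin m) ℂ} (hF : MemH2 F) {x : ℝ} (hx : 0 < x) :
    sliceLp F x = (hF.memLp hx).toLp (slice F x) := by
  rw [sliceLp, dif_pos (hF.memLp hx)]

lemma MemH2.coeFn_sliceLp {F : ℂ → Matrix (Fin p) (Fin m) ℂ} (hF : MemH2 F) {x : ℝ}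
    (hx : 0 < x) : sliceLp F x =ᵐ[volume] slice F x := by
  rw [hF.sliceLp_eq hx]
  exact MemLp.coeFn_toLp _

lemma MemH2.inner_sliceLp {F G : ℂ → Matrix (Fin p) (Fin m) ℂ} (hF : MemH2 F) (hG : MemH2 G)
    {x y : ℝ} (hx : 0 < x) (hy : 0 < y) :
    inner ℂ (sliceLp F x) (sliceLp G y) = ∫ t : ℝ, inner ℂ (slice F x t) (slice G y t) := by
  rw [L2.inner_def]
  refine integral_congr_ae ?_
  filter_upwards [hF.coeFn_sliceLp hx, hG.coeFn_sliceLp hy] with t h1 h2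
  rw [h1, h2]

/-- The restrictions of a Hardy function to vertical lines converge in `L²` at the boundary. -/
theorem MemH2.tendsto_sliceLp {F : ℂ → Matrix (Fin p) (Fin m) ℂ} (hF : MemH2 F) :
    Tendsto (sliceLp F) (𝓝[>] 0) (𝓝 (boundary F)) := by
  obtain ⟨C, hC⟩ := memH2_iff.1 hF
  refine tendsto_nhds_limUnder (exists_tendsto_of_inner_eq (C := C) (fun x hx => ?_) ?_)
  · have h1 := inner_self_eq_norm_sq (𝕜 := ℂ) (sliceLp F x)
    rw [← h1, hF.inner_sliceLp hF hx hx]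
    have h2 : ∀ t : ℝ, inner ℂ (slice F x t) (slice F x t) =
        ((‖slice F x t‖ ^ 2 : ℝ) : ℂ) := fun t => by
      rw [inner_self_eq_norm_sq_to_K]; norm_cast
    simp_rw [h2]
    rw [integral_complex_ofReal]
    exact hC.integral_le x hx
  · intro x hx y hy
    have hmid : 0 < (x + y) / 2 := by linarith
    rw [hF.inner_sliceLp hF hx hy, hF.inner_sliceLp hF hmid hmid]
    rcases le_total y x with h | h
    · exact hC.integral_inner_eq hmid hy (by linarith) (by ring)
    · exact (hC.integral_inner_eq hx hmid (by linarith) (by ring)).symm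

lemma boundary_congr {F G : ℂ → Matrix (Fin p) (Fin m) ℂ}
    (h : ∀ s : ℂ, 0 < s.re → F s = G s) : boundary F = boundary G := by
  have : sliceLp F =ᶠ[𝓝[>] 0] sliceLp G := by
    filter_upwards [self_mem_nhdsWithin] with x hx
    have : slice F x = slice G x := by
      funext y
      rw [slice, slice, h _ (by simpa using hx)]
    unfold sliceLp
    rw [this]
  unfold boundary limUnder
  rw [map_congr this]

lemma MemH2.congr {F G : ℂ → Matrix (Fin p) (Fin m) ℂ} (hF : MemH2 F)
    (h : ∀ s : ℂ, 0 < s.re → F s = G s) : MemH2 G := by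
  refine ⟨fun i j => (hF.analytic i j).congr fun s hs => by rw [h s hs], ?_⟩
  convert hF.bounded using 5 with x hx
  funext y
  rw [slice, slice, h _ (by simpa using hx)]

lemma vec_add (M N : Matrix (Fin p) (Fin m) ℂ) : vec (M + N) = vec M + vec N := rfl

lemma vec_smul (a : ℂ) (M : Matrix (Fin p) (Fin m) ℂ) : vec (a • M) = a • vec M := rfl

lemma MemH2.sub {F G : ℂ → Matrix (Fin p) (Fin m) ℂ} (hF : MemH2 F) (hG : MemH2 G) :
    MemH2 (F - G) := by
  obtain ⟨C, hC⟩ := memH2_iff.1 hF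
  obtain ⟨D, hD⟩ := memH2_iff.1 hG
  exact memH2_iff.2 ⟨_, hC.sub hD⟩

lemma MemH2.smul {F : ℂ → Matrix (Fin p) (Fin m) ℂ} (hF : MemH2 F) (a : ℂ) :
    MemH2 (a • F) := by
  obtain ⟨C, hC⟩ := memH2_iff.1 hF
  refine memH2_iff.2 ⟨‖a‖ ^ 2 * C, hC.differentiableOn.const_smul a,
    fun x hx => (hC.memLp x hx).const_smul a, fun x hx => ?_⟩
  simp only [Pi.smul_apply, vec_smul, norm_smul, mul_pow]
  rw [integral_const_mul]
  exact mul_le_mul_of_nonneg_left (hC.integral_le x hx) (by positivity)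

lemma MemH2.zero : MemH2 (0 : ℂ → Matrix (Fin p) (Fin m) ℂ) := by
  refine ⟨fun i j => differentiableOn_const 0, ?_⟩
  have h0 : ∀ ξ y : ℝ, slice (0 : ℂ → Matrix (Fin p) (Fin m) ℂ) ξ y = 0 := fun _ _ => rfl
  simp [h0]

lemma MemH2.add {F G : ℂ → Matrix (Fin p) (Fin m) ℂ} (hF : MemH2 F) (hG : MemH2 G) :
    MemH2 (F + G) := by
  have := hF.sub (hG.smul (-1))
  rwa [neg_one_smul, sub_neg_eq_add] at this

lemma MemH2.sum {κ : Type*} (S : Finset κ) {F : κ → ℂ → Matrix (Fin p) (Fin m) ℂ}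
    (hF : ∀ k ∈ S, MemH2 (F k)) : MemH2 (∑ k ∈ S, F k) :=
  Finset.sum_induction F MemH2 (fun _ _ => MemH2.add) MemH2.zero hF

lemma MemH2.boundary_add {F G : ℂ → Matrix (Fin p) (Fin m) ℂ} (hF : MemH2 F) (hG : MemH2 G) :
    boundary (F + G) = boundary F + boundary G := by
  refine tendsto_nhds_unique (hF.add hG).tendsto_sliceLp
    ((hF.tendsto_sliceLp.add hG.tendsto_sliceLp).congr' ?_)
  filter_upwards [self_mem_nhdsWithin] with x hx
  rw [hF.sliceLp_eq hx, hG.sliceLp_eq hx, (hF.add hG).sliceLp_eq hx, ← MemLp.toLp_add]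
  rfl

lemma MemH2.boundary_smul {F : ℂ → Matrix (Fin p) (Fin m) ℂ} (hF : MemH2 F) (a : ℂ) :
    boundary (a • F) = a • boundary F := by
  refine tendsto_nhds_unique (hF.smul a).tendsto_sliceLp
    ((hF.tendsto_sliceLp.const_smul a).congr' ?_)
  filter_upwards [self_mem_nhdsWithin] with x hx
  rw [hF.sliceLp_eq hx, (hF.smul a).sliceLp_eq hx, ← MemLp.toLp_const_smul]
  rfl

lemma boundary_zero : boundary (0 : ℂ → Matrix (Fin p) (Fin m) ℂ) = 0 := by
  have := MemH2.boundary_smul (MemH2.zero (p := p) (m := m)) 0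
  rwa [zero_smul, zero_smul] at this

lemma boundary_sum {κ : Type*} (S : Finset κ) {F : κ → ℂ → Matrix (Fin p) (Fin m) ℂ}
    (hF : ∀ k ∈ S, MemH2 (F k)) : boundary (∑ k ∈ S, F k) = ∑ k ∈ S, boundary (F k) := by
  classical
  induction S using Finset.induction_on with
  | empty => simpa using boundary_zero
  | insert a S ha ih =>
    rw [Finset.sum_insert ha, Finset.sum_insert ha, MemH2.boundary_add (hF a (by simp))
      (MemH2.sum S fun k hk => hF k (by simp [hk])), ih fun k hk => hF k (by simp [hk])]

/-- The boundary values of a Hardy function that is continuous at the imaginary axis. -/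
lemma MemH2.coeFn_boundary {F : ℂ → Matrix (Fin p) (Fin m) ℂ} (hF : MemH2 F)
    (hc : ∀ y : ℝ, ContinuousAt (fun s => vec (F s)) ((y : ℂ) * Complex.I)) :
    boundary F =ᵐ[volume] fun y : ℝ => vec (F ((y : ℂ) * Complex.I)) := by
  obtain ⟨u, -, hupos, hu⟩ := exists_seq_strictAnti_tendsto (0 : ℝ)
  have hu' : Tendsto u atTop (𝓝[>] 0) :=
    tendsto_nhdsWithin_iff.2 ⟨hu, Eventually.of_forall fun n => hupos n⟩
  obtain ⟨φ, hφ, hae⟩ := (tendstoInMeasure_of_tendsto_Lp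
    (hF.tendsto_sliceLp.comp hu')).exists_seq_tendsto_ae
  have hall : ∀ᵐ y : ℝ, ∀ n, sliceLp F (u n) y = slice F (u n) y :=
    ae_all_iff.2 fun n => hF.coeFn_sliceLp (hupos n)
  filter_upwards [hae, hall] with y h1 h2
  refine tendsto_nhds_unique h1 ?_
  simp only [Function.comp_apply, h2, slice]
  have h3 : Tendsto (fun n => ((u (φ n) : ℝ) : ℂ) + (y : ℂ) * Complex.I) atTop
      (𝓝 ((y : ℂ) * Complex.I)) := by
    have : Continuous fun x : ℝ => (x : ℂ) + (y : ℂ) * Complex.I := by fun_prop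
    have h4 := (this.tendsto 0).comp (hu.comp hφ.tendsto_atTop)
    simp only [Complex.ofReal_zero, zero_add] at h4
    exact h4
  exact (hc y).tendsto.comp h3

lemma trace_unvec (v w : FrobSpace p m) : ((unvec v)ᴴ * unvec w).trace = inner ℂ v w := by
  simp only [Matrix.trace, Matrix.diag_apply, Matrix.mul_apply, Matrix.conjTranspose_apply, unvec,
    Matrix.of_apply, PiLp.inner_apply, RCLike.inner_apply, Fintype.sum_prod_type]
  rw [Finset.sum_comm]
  refine Finset.sum_congr rfl fun i _ => Finset.sum_congr rfl fun j _ => ?_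
  rw [mul_comm]
  rfl

lemma innerH2_eq (F G : ℂ → Matrix (Fin p) (Fin m) ℂ) :
    innerH2 F G = (1 / (2 * (Real.pi : ℂ))) * inner ℂ (boundary F) (boundary G) := by
  rw [innerH2, L2.inner_def]
  simp_rw [trace_unvec]

end Boundary

/-! ### Functions with a single pole -/

section Pole

variable {p m : ℕ}

/-- The function `s ↦ M / (s - μ)`. -/
def pole (μ : ℂ) (M : Matrix (Fin p) (Fin m) ℂ) : ℂ → Matrix (Fin p) (Fin m) ℂ :=
  fun s => (s - μ)⁻¹ • M

/-- The function `s ↦ M / (s - μ)²`. -/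
def doublePole (μ : ℂ) (M : Matrix (Fin p) (Fin m) ℂ) : ℂ → Matrix (Fin p) (Fin m) ℂ :=
  fun s => ((s - μ)⁻¹ ^ 2) • M

lemma pole_add (μ : ℂ) (M N : Matrix (Fin p) (Fin m) ℂ) : pole μ (M + N) = pole μ M + pole μ N :=
  funext fun _ => smul_add _ _ _

lemma pole_smul (μ a : ℂ) (M : Matrix (Fin p) (Fin m) ℂ) : pole μ (a • M) = a • pole μ M :=
  funext fun _ => smul_comm _ _ _

lemma memH2_pole {μ : ℂ} (hμ : μ.re < 0) (M : Matrix (Fin p) (Fin m) ℂ) : MemH2 (pole μ M) :=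
  memH2_iff.2 ⟨_, isHardy_inv_sub_smul hμ (vec M)⟩

lemma memH2_doublePole {μ : ℂ} (hμ : μ.re < 0) (M : Matrix (Fin p) (Fin m) ℂ) :
    MemH2 (doublePole μ M) := by
  refine memH2_iff.2 ⟨_, IsHardy.of_norm_le (K := (-μ.re)⁻¹ * ‖vec M‖) hμ ?_ fun z hz => ?_⟩
  · intro z hz
    have : z - μ ≠ 0 := by
      intro h
      rw [sub_eq_zero.1 h] at hz
      exact absurd hz (not_lt.2 hμ.le)
    exact ((((differentiableAt_id.sub_const μ).inv this).pow 2).smul_const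
      (vec M)).differentiableWithinAt
  · have h1 : ‖(z - μ)⁻¹‖ ≤ (-μ.re)⁻¹ :=
      norm_inv_le_of_re (neg_pos.2 hμ) (by rw [Complex.sub_re]; linarith)
    calc ‖vec (doublePole μ M z)‖ = ‖(z - μ)⁻¹‖ * ‖vec M‖ * ‖(z - μ)⁻¹‖ := by
          rw [doublePole, vec_smul, norm_smul, norm_pow]; ring
      _ ≤ (-μ.re)⁻¹ * ‖vec M‖ * ‖(z - μ)⁻¹‖ := by gcongr

/-- Functions with a simple pole are reproducing kernels of the Hardy space. -/
theorem MemH2.inner_boundary_pole {F : ℂ → Matrix (Fin p) (Fin m) ℂ} (hF : MemH2 F) {μ : ℂ}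
    (hμ : μ.re < 0) (M : Matrix (Fin p) (Fin m) ℂ) :
    inner ℂ (boundary F) (boundary (pole μ M)) =
      (2 * Real.pi : ℂ) * inner ℂ (vec (F (-star μ))) (vec M) := by
  obtain ⟨C, hC⟩ := memH2_iff.1 hF
  have hP := memH2_pole hμ M
  refine tendsto_nhds_unique (hF.tendsto_sliceLp.inner hP.tendsto_sliceLp) ?_
  have hopen : IsOpen {z : ℂ | 0 < z.re} := isOpen_lt continuous_const Complex.continuous_re
  have hcont : ContinuousAt (fun s => vec (F s)) (-star μ) :=
    (hC.differentiableOn.differentiableAt (hopen.mem_nhds (by simpa using hμ))).continuousAt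
  have hlim : Tendsto (fun x : ℝ => vec (F (2 * (x : ℂ) - star μ))) (𝓝[>] 0)
      (𝓝 (vec (F (-star μ)))) := by
    refine hcont.tendsto.comp ?_
    have : Continuous fun x : ℝ => 2 * (x : ℂ) - star μ := by fun_prop
    have h := this.tendsto 0
    simp only [Complex.ofReal_zero, mul_zero, zero_sub] at h
    exact h.mono_left nhdsWithin_le_nhds
  refine ((hlim.inner tendsto_const_nhds).const_mul (2 * Real.pi : ℂ)).congr' ?_
  filter_upwards [self_mem_nhdsWithin] with x hx
  rw [Set.mem_Ioi] at hx
  have hre : x < (2 * (x : ℂ) - star μ).re := by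
    simp
    linarith
  rw [hF.inner_sliceLp hP hx hx]
  have hpt : ∀ y : ℝ, inner ℂ (slice F x y) (slice (pole μ M) x y) =
      (starRingEnd ℂ) (inner ℂ (vec M) ((2 * (x : ℂ) - star μ -
        ((x : ℂ) + (y : ℂ) * Complex.I))⁻¹ • vec (F ((x : ℂ) + (y : ℂ) * Complex.I)))) := by
    intro y
    rw [inner_conj_symm, inner_smul_left, slice, slice, pole, vec_smul, inner_smul_right, map_inv₀]
    congr 2
    apply Complex.ext
    · simp; ring
    · simp; ring
  simp_rw [hpt]
  rw [integral_conj, integral_inner (hC.integrable_inv_sub_smul hx hre),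
    hC.integral_inv_sub_smul hx hre, inner_conj_symm, inner_smul_left]
  congr 1
  rw [map_mul, Complex.conj_ofReal, map_ofNat]

lemma line_sub_ne_zero {μ : ℂ} (hμ : μ.re < 0) (y : ℝ) : (y : ℂ) * Complex.I - μ ≠ 0 := by
  intro h
  have := congrArg Complex.re h
  simp at this
  linarith

lemma coeFn_boundary_pole {μ : ℂ} (hμ : μ.re < 0) (M : Matrix (Fin p) (Fin m) ℂ) :
    boundary (pole μ M) =ᵐ[volume] fun y : ℝ => ((y : ℂ) * Complex.I - μ)⁻¹ • vec M := by
  refine (memH2_pole hμ M).coeFn_boundary fun y => ?_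
  have h : ContinuousAt (fun s : ℂ => (s - μ)⁻¹) ((y : ℂ) * Complex.I) :=
    (continuousAt_id.sub continuousAt_const).inv₀ (line_sub_ne_zero hμ y)
  simp only [pole, vec_smul]
  exact h.smul_const _

lemma coeFn_boundary_doublePole {μ : ℂ} (hμ : μ.re < 0) (M : Matrix (Fin p) (Fin m) ℂ) :
    boundary (doublePole μ M) =ᵐ[volume]
      fun y : ℝ => (((y : ℂ) * Complex.I - μ)⁻¹ ^ 2) • vec M := by
  refine (memH2_doublePole hμ M).coeFn_boundary fun y => ?_
  have h : ContinuousAt (fun s : ℂ => (s - μ)⁻¹) ((y : ℂ) * Complex.I) :=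
    (continuousAt_id.sub continuousAt_const).inv₀ (line_sub_ne_zero hμ y)
  simp only [doublePole, vec_smul]
  exact (h.pow 2).smul_const _

lemma memLp_top_kernel {μ : ℂ} (hμ : μ.re < 0) :
    MemLp (fun y : ℝ => ((y : ℂ) * Complex.I - μ)⁻¹) ∞ volume := by
  refine memLp_top_of_bound (C := (-μ.re)⁻¹) ?_ (ae_of_all _ fun y => ?_)
  · exact (Continuous.inv₀ (by fun_prop) (line_sub_ne_zero hμ)).aestronglyMeasurable
  · exact norm_inv_le_of_re (neg_pos.2 hμ) (by simp)

/-- Multiplication by `y ↦ 1 / (i y - μ)` on `L²`. -/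
def kernelMul (p m : ℕ) {μ : ℂ} (hμ : μ.re < 0) :
    Lp (FrobSpace p m) 2 (volume : Measure ℝ) →L[ℂ] Lp (FrobSpace p m) 2 (volume : Measure ℝ) :=
  (ContinuousLinearMap.lsmul ℂ ℂ).holderL volume ∞ 2 2 ((memLp_top_kernel hμ).toLp _)

lemma coeFn_kernelMul {μ : ℂ} (hμ : μ.re < 0) (f : Lp (FrobSpace p m) 2 (volume : Measure ℝ)) :
    kernelMul p m hμ f =ᵐ[volume] fun y : ℝ => ((y : ℂ) * Complex.I - μ)⁻¹ • f y := by
  have h1 := (ContinuousLinearMap.lsmul ℂ ℂ : ℂ →L[ℂ] FrobSpace p m →L[ℂ] _).coeFn_holder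
    (r := 2) ((memLp_top_kernel hμ).toLp _) f
  filter_upwards [h1, (memLp_top_kernel hμ).coeFn_toLp] with y h2 h3
  refine h2.trans ?_
  rw [h3]
  rfl

lemma kernelMul_boundary_pole {μ : ℂ} (hμ : μ.re < 0) (M : Matrix (Fin p) (Fin m) ℂ) :
    kernelMul p m hμ (boundary (pole μ M)) = boundary (doublePole μ M) := by
  refine Lp.ext ?_
  filter_upwards [coeFn_kernelMul hμ (boundary (pole μ M)), coeFn_boundary_pole hμ M,
    coeFn_boundary_doublePole hμ M] with y h1 h2 h3
  rw [h1, h2, h3, smul_smul, sq]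

/-- The resolvent identity for simple poles. -/
lemma one_sub_smul_kernelMul_boundary_pole {μ h : ℂ} (hμ : μ.re < 0) (hμh : (μ + h).re < 0)
    (M : Matrix (Fin p) (Fin m) ℂ) :
    (1 - h • kernelMul p m hμ) (boundary (pole (μ + h) M)) = boundary (pole μ M) := by
  refine Lp.ext ?_
  rw [sub_apply, one_apply_eq_self,
    smul_apply]
  filter_upwards [coeFn_kernelMul hμ (boundary (pole (μ + h) M)), coeFn_boundary_pole hμ M,
    coeFn_boundary_pole hμh M,
    Lp.coeFn_sub (boundary (pole (μ + h) M)) (h • kernelMul p m hμ (boundary (pole (μ + h) M))),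
    Lp.coeFn_smul h (kernelMul p m hμ (boundary (pole (μ + h) M)))] with y h1 h2 h3 h4 h5
  rw [h4, Pi.sub_apply, h5, Pi.smul_apply, h1, h2, h3, smul_smul, smul_smul, ← sub_smul]
  congr 1
  have e1 := line_sub_ne_zero hμ y
  have e2 := line_sub_ne_zero hμh y
  field_simp
  ring

lemma boundary_pole_add {μ h : ℂ} (hμ : μ.re < 0) (hμh : (μ + h).re < 0)
    (hu : IsUnit (1 - h • kernelMul p m hμ)) (M : Matrix (Fin p) (Fin m) ℂ) :
    boundary (pole (μ + h) M) = Ring.inverse (1 - h • kernelMul p m hμ) (boundary (pole μ M)) := by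
  rw [← one_sub_smul_kernelMul_boundary_pole hμ hμh M, ← mul_apply_eq_comp,
    Ring.inverse_mul_cancel _ hu, one_apply_eq_self]

/-- Smoothness of `t ↦ (1 - t ν T)⁻¹ (v₀ + t v₁ + t² v₂)` near `t = 0`. -/
lemma eventually_contDiffAt_inverse_apply {L : Type*} [NormedAddCommGroup L] [NormedSpace ℂ L]
    [NormedSpace ℝ L] [IsScalarTower ℝ ℂ L] [CompleteSpace L] (T : L →L[ℂ] L) (ν : ℂ)
    (v₀ v₁ v₂ : L) :
    (∀ᶠ t : ℝ in 𝓝 0, IsUnit (1 - ((t : ℂ) * ν) • T) ∧ ContDiffAt ℝ ∞ (fun t : ℝ =>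
      Ring.inverse (1 - ((t : ℂ) * ν) • T) (v₀ + (t : ℂ) • v₁ + ((t : ℂ) ^ 2) • v₂)) t) ∧
    HasDerivAt (fun t : ℝ =>
      Ring.inverse (1 - ((t : ℂ) * ν) • T) (v₀ + (t : ℂ) • v₁ + ((t : ℂ) ^ 2) • v₂))
      (ν • T v₀ + v₁) 0 := by
  set U : ℂ → L →L[ℂ] L := fun z => 1 - (z * ν) • T with hU
  set V : ℂ → L := fun z => v₀ + z • v₁ + (z ^ 2) • v₂ with hV
  have hUd : ContDiff ℂ ∞ U :=
    contDiff_const.sub ((contDiff_id.mul contDiff_const).smul contDiff_const)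
  have hVd : ContDiff ℂ ∞ V :=
    (contDiff_const.add (contDiff_id.smul contDiff_const)).add
      ((contDiff_id.pow 2).smul contDiff_const)
  have hU0 : U 0 = 1 := by simp [hU]
  have hV0 : V 0 = v₀ := by simp [hV]
  have hunit : ∀ᶠ z in 𝓝 (0 : ℂ), IsUnit (U z) := by
    have : ∀ᶠ A in 𝓝 (U 0), IsUnit A := by
      rw [hU0]
      exact Units.isOpen.mem_nhds isUnit_one
    exact hUd.continuous.tendsto 0 this
  have hinv : ∀ z, IsUnit (U z) → ContDiffAt ℂ ∞ (fun z => Ring.inverse (U z) (V z)) z := by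
    rintro z ⟨u, hu⟩
    have h1 : ContDiffAt ℂ ∞ Ring.inverse (U z) := by
      rw [← hu]; exact contDiffAt_ringInverse ℂ u
    exact (h1.comp z hUd.contDiffAt).clm_apply hVd.contDiffAt
  constructor
  · have h0 : Tendsto (fun t : ℝ => (t : ℂ)) (𝓝 0) (𝓝 0) := by
      have := Complex.continuous_ofReal.tendsto 0
      rwa [Complex.ofReal_zero] at this
    filter_upwards [h0.eventually hunit] with t ht
    exact ⟨ht, ((hinv _ ht).restrict_scalars ℝ).comp t Complex.ofRealCLM.contDiff.contDiffAt⟩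
  · have dU : HasDerivAt U (-(ν • T)) 0 := by
      have := (((hasDerivAt_id (0 : ℂ)).mul_const ν).smul_const T).const_sub 1
      simpa using this
    have dI : HasDerivAt (fun z => Ring.inverse (U z)) (ν • T) 0 := by
      have h := hasFDerivAt_ringInverse (𝕜 := ℂ) (1 : (L →L[ℂ] L)ˣ)
      rw [Units.val_one, ← hU0] at h
      have h2 := h.comp_hasDerivAt 0 dU
      simpa using! h2
    have dV : HasDerivAt V v₁ 0 := by
      have := (((hasDerivAt_id (0 : ℂ)).smul_const v₁).const_add v₀).add
        (((hasDerivAt_id (0 : ℂ)).pow 2).smul_const v₂)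
      simpa using! this
    have h := dI.clm_apply dV
    rw [hU0, hV0, Ring.inverse_one] at h
    have d1 : HasDerivAt (fun t : ℝ => (t : ℂ)) 1 0 := Complex.ofRealCLM.hasDerivAt
    have h2 := HasDerivAt.scomp_of_eq (0 : ℝ) h d1 (by simp)
    rw [one_smul] at h2
    exact h2

/-- Simple poles with moving pole and residue trace out smooth curves in `L²`. -/
lemma eventually_contDiffAt_boundary_pole {μ : ℂ} (hμ : μ.re < 0) (ν : ℂ)
    (M₀ M₁ M₂ : Matrix (Fin p) (Fin m) ℂ) :
    (∀ᶠ t : ℝ in 𝓝 0, (μ + t * ν).re < 0 ∧ ContDiffAt ℝ ∞ (fun t : ℝ =>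
      boundary (pole (μ + t * ν) (M₀ + (t : ℂ) • M₁ + ((t : ℂ) ^ 2) • M₂))) t) ∧
    HasDerivAt (fun t : ℝ =>
      boundary (pole (μ + t * ν) (M₀ + (t : ℂ) • M₁ + ((t : ℂ) ^ 2) • M₂)))
      (ν • boundary (doublePole μ M₀) + boundary (pole μ M₁)) 0 := by
  obtain ⟨h1, h2⟩ := eventually_contDiffAt_inverse_apply (kernelMul p m hμ) ν
    (boundary (pole μ M₀)) (boundary (pole μ M₁)) (boundary (pole μ M₂))
  have hre : ∀ᶠ t : ℝ in 𝓝 0, (μ + t * ν).re < 0 := by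
    have : Continuous fun t : ℝ => (μ + t * ν).re := by fun_prop
    have h0 : (μ + ((0 : ℝ) : ℂ) * ν).re < 0 := by simpa using hμ
    exact this.tendsto 0 (gt_mem_nhds h0)
  have heq : ∀ᶠ t : ℝ in 𝓝 0,
      boundary (pole (μ + t * ν) (M₀ + (t : ℂ) • M₁ + ((t : ℂ) ^ 2) • M₂)) =
        Ring.inverse (1 - ((t : ℂ) * ν) • kernelMul p m hμ) (boundary (pole μ M₀) +
          (t : ℂ) • boundary (pole μ M₁) + ((t : ℂ) ^ 2) • boundary (pole μ M₂)) := by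
    filter_upwards [h1, hre] with t h3 h4
    rw [boundary_pole_add hμ h4 h3.1]
    congr 1
    have P := fun M => memH2_pole (p := p) (m := m) hμ M
    rw [pole_add, pole_add, pole_smul, pole_smul, MemH2.boundary_add ((P _).add ((P _).smul _))
      ((P _).smul _), MemH2.boundary_add (P _) ((P _).smul _), (P _).boundary_smul,
      (P _).boundary_smul]
  constructor
  · filter_upwards [eventually_eventually_nhds.2 heq, h1, hre] with t h3 h4 h5
    exact ⟨h5, h4.2.congr_of_eventuallyEq h3⟩
  · rw [kernelMul_boundary_pole hμ] at h2
    exact h2.congr_of_eventuallyEq heq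

lemma MemH2.hasDerivAt_vec {F : ℂ → Matrix (Fin p) (Fin m) ℂ} (hF : MemH2 F) {s : ℂ}
    (hs : 0 < s.re) : HasDerivAt (fun s => vec (F s)) (vec (derivMatrix F s)) s := by
  have hopen : IsOpen {z : ℂ | 0 < z.re} := isOpen_lt continuous_const Complex.continuous_re
  have h := ((differentiableOn_vec.2 hF.analytic).differentiableAt
    (hopen.mem_nhds hs)).hasDerivAt
  have heq : deriv (fun s => vec (F s)) s = vec (derivMatrix F s) := by
    ext ij
    exact ((EuclideanSpace.proj (𝕜 := ℂ) ij).hasFDerivAt.comp_hasDerivAt s h).deriv.symm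
  rwa [heq] at h

/-- Functions with a double pole evaluate derivatives. -/
theorem MemH2.inner_boundary_doublePole {F : ℂ → Matrix (Fin p) (Fin m) ℂ} (hF : MemH2 F) {μ : ℂ}
    (hμ : μ.re < 0) (M : Matrix (Fin p) (Fin m) ℂ) :
    inner ℂ (boundary F) (boundary (doublePole μ M)) =
      -(2 * Real.pi : ℂ) * inner ℂ (vec (derivMatrix F (-star μ))) (vec M) := by
  obtain ⟨hev, hd⟩ := eventually_contDiffAt_boundary_pole hμ 1 M 0 0
  have P0 : boundary (pole μ (0 : Matrix (Fin p) (Fin m) ℂ)) = 0 := by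
    rw [← zero_smul ℂ (0 : Matrix (Fin p) (Fin m) ℂ), pole_smul, zero_smul, boundary_zero]
  simp only [smul_zero, add_zero, one_smul, mul_one, P0] at hd hev
  have h1 := (hasDerivAt_const (0 : ℝ) (boundary F)).inner ℂ hd
  rw [inner_zero_left, add_zero] at h1
  have hvec := hF.hasDerivAt_vec (s := -star μ) (by simpa using hμ)
  have d1 : HasDerivAt (fun t : ℝ => -star μ - (t : ℂ)) (-1) 0 :=
    Complex.ofRealCLM.hasDerivAt.const_sub (-star μ)
  have hvec' : HasDerivAt (fun t : ℝ => vec (F (-star μ - (t : ℂ))))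
      ((-1 : ℂ) • vec (derivMatrix F (-star μ))) 0 :=
    HasDerivAt.scomp_of_eq (0 : ℝ) hvec d1 (by simp)
  have h2 := (hvec'.inner ℂ (hasDerivAt_const (0 : ℝ) (vec M))).const_mul (2 * Real.pi : ℂ)
  have h3 : HasDerivAt (fun t : ℝ => inner ℂ (boundary F) (boundary (pole (μ + (t : ℂ)) M)))
      _ 0 := h2.congr_of_eventuallyEq ?_
  · rw [h1.unique h3, inner_zero_right, zero_add, inner_smul_left]
    simp
  · filter_upwards [hev] with t ht
    rw [hF.inner_boundary_pole ht.1]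
    congr 4
    simp [add_comm]
    ring

end Pole

/-! ### Transfer functions -/

section Transfer

attribute [local instance] Matrix.linftyOpNormedRing Matrix.linftyOpNormedAlgebra

variable {r m p : ℕ}

lemma isUnit_smul_one_sub {A : Matrix (Fin r) (Fin r) ℂ} {s : ℂ} (hs : s ∉ spectrum ℂ A) :
    IsUnit (s • (1 : Matrix (Fin r) (Fin r) ℂ) - A) := by
  rw [← Algebra.algebraMap_eq_smul_one]
  exact not_not.1 hs

lemma isUnit_det_smul_one_sub {A : Matrix (Fin r) (Fin r) ℂ} {s : ℂ} (hs : s ∉ spectrum ℂ A) :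
    IsUnit (s • (1 : Matrix (Fin r) (Fin r) ℂ) - A).det :=
  (Matrix.isUnit_iff_isUnit_det _).1 (isUnit_smul_one_sub hs)

/-- The transfer function as a linear image of the resolvent. -/
def transferMap (B : Matrix (Fin r) (Fin m) ℂ) (C : Matrix (Fin p) (Fin r) ℂ) :
    Matrix (Fin r) (Fin r) ℂ →ₗ[ℂ] FrobSpace p m where
  toFun R := vec (C * R * B)
  map_add' R S := by rw [Matrix.mul_add, Matrix.add_mul, vec_add]
  map_smul' a R := by rw [Matrix.mul_smul, Matrix.smul_mul, vec_smul]; rfl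

lemma vec_transfer (A : Matrix (Fin r) (Fin r) ℂ) (B : Matrix (Fin r) (Fin m) ℂ)
    (C : Matrix (Fin p) (Fin r) ℂ) (s : ℂ) :
    vec (transfer A B C s) = (transferMap B C).toContinuousLinearMap (resolvent A s) := by
  rw [transfer, resolvent, Algebra.algebraMap_eq_smul_one, Matrix.nonsing_inv_eq_ringInverse]
  rfl

lemma differentiableAt_vec_transfer {A : Matrix (Fin r) (Fin r) ℂ} {B : Matrix (Fin r) (Fin m) ℂ}
    {C : Matrix (Fin p) (Fin r) ℂ} {s : ℂ} (hs : s ∉ spectrum ℂ A) :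
    DifferentiableAt ℂ (fun s => vec (transfer A B C s)) s := by
  simp_rw [vec_transfer]
  have h : s ∈ resolventSet ℂ A := not_not.1 hs
  exact (transferMap B C).toContinuousLinearMap.differentiableAt.comp s
    (spectrum.hasDerivAt_resolvent_const_left h).differentiableAt

/-- The resolvent of a Hurwitz matrix decays like `1 / s` on the right half-plane. -/
lemma IsHurwitz.exists_norm_resolvent_le {A : Matrix (Fin r) (Fin r) ℂ} (hA : IsHurwitz A) :
    ∃ K, 0 ≤ K ∧ ∀ s : ℂ, 0 ≤ s.re → ‖resolvent A s‖ ≤ K * ‖(s - (-1))⁻¹‖ := by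
  have hns : ∀ s : ℂ, 0 ≤ s.re → s ∈ resolventSet ℂ A := fun s hs =>
    not_not.1 fun h => (not_lt.2 hs) (hA s h)
  obtain ⟨c, hc⟩ := (spectrum.resolvent_isBigO_inv (𝕜 := ℂ) A).bound
  obtain ⟨R, -, hR⟩ := (atTop_basis_Ioi.cobounded_of_norm (E := ℂ)).eventually_iff.1 hc
  set R' := max R 1 with hR'
  have hcont : ContinuousOn (resolvent A) (Metric.closedBall (0 : ℂ) R' ∩ {s | 0 ≤ s.re}) :=
    fun s hs => (spectrum.hasDerivAt_resolvent_const_left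
      (hns s hs.2)).continuousAt.continuousWithinAt
  have hcomp : IsCompact (Metric.closedBall (0 : ℂ) R' ∩ {s | 0 ≤ s.re}) :=
    (isCompact_closedBall _ _).inter_right (isClosed_le continuous_const Complex.continuous_re)
  obtain ⟨K₁, hK₁⟩ := hcomp.exists_bound_of_continuousOn hcont
  refine ⟨|K₁| * (R' + 1) + 2 * |c|, by positivity, fun s hs => ?_⟩
  have hre : 1 ≤ (s - (-1)).re := by simpa using hs
  have hpos : 0 < ‖s - (-1)‖ := lt_of_lt_of_le one_pos (hre.trans (Complex.re_le_norm _))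
  have htri : ‖s - (-1)‖ ≤ ‖s‖ + 1 := by simpa using norm_sub_le s (-1)
  rw [norm_inv, ← div_eq_mul_inv, le_div_iff₀ hpos]
  have hR0 : 1 ≤ R' := le_max_right _ _
  rcases le_or_gt ‖s‖ R' with h | h
  · have h1 : ‖resolvent A s‖ ≤ |K₁| :=
      (hK₁ s ⟨by simpa using h, hs⟩).trans (le_abs_self _)
    calc ‖resolvent A s‖ * ‖s - (-1)‖ ≤ |K₁| * (R' + 1) := by
          gcongr
          linarith
      _ ≤ _ := le_add_of_nonneg_right (by positivity)
  · have h1 : ‖resolvent A s‖ ≤ |c| * ‖s‖⁻¹ := by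
      refine (hR (show s ∈ norm ⁻¹' Set.Ioi R from (le_max_left _ _).trans_lt h)).trans ?_
      rw [norm_inv]
      gcongr
      exact le_abs_self c
    have hs0 : 0 < ‖s‖ := by linarith
    calc ‖resolvent A s‖ * ‖s - (-1)‖ ≤ |c| * ‖s‖⁻¹ * (2 * ‖s‖) := by
          gcongr
          linarith
      _ = 2 * |c| := by field_simp
      _ ≤ _ := le_add_of_nonneg_left (by positivity)

lemma exists_norm_linearMap_le {V W : Type*} [NormedAddCommGroup V] [NormedSpace ℂ V]
    [FiniteDimensional ℂ V] [NormedAddCommGroup W] [NormedSpace ℂ W] (T : V →ₗ[ℂ] W) :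
    ∃ K, 0 < K ∧ ∀ x, ‖T x‖ ≤ K * ‖x‖ :=
  T.toContinuousLinearMap.bound

theorem memH2_transfer {A : Matrix (Fin r) (Fin r) ℂ} (hA : IsHurwitz A)
    (B : Matrix (Fin r) (Fin m) ℂ) (C : Matrix (Fin p) (Fin r) ℂ) : MemH2 (transfer A B C) := by
  obtain ⟨K, hK0, hK⟩ := hA.exists_norm_resolvent_le
  obtain ⟨K', hK'0, hK'⟩ := exists_norm_linearMap_le (transferMap B C)
  refine memH2_iff.2 ⟨_, IsHardy.of_norm_le (ρ := -1) (K := K' * K) (by simp) ?_ fun z hz => ?_⟩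
  · intro s hs
    exact (differentiableAt_vec_transfer fun h =>
      (lt_asymm (hA s h)) hs).differentiableWithinAt
  · rw [vec_transfer, mul_assoc]
    refine (hK' _).trans ?_
    gcongr
    exact hK z hz.le

lemma memH2_of_mem_stableRational {F : ℂ → Matrix (Fin p) (Fin m) ℂ}
    (hF : F ∈ StableRational r m p) : MemH2 F := by
  obtain ⟨A, B, C, hA, -, h⟩ := hF
  exact (memH2_transfer hA B C).congr fun s hs => (h s hs).symm

lemma vec_injective : Function.Injective (vec : Matrix (Fin p) (Fin m) ℂ → FrobSpace p m) := by
  intro M N h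
  ext i j
  exact congrArg (fun v : FrobSpace p m => v (i, j)) h

/-- Transfer functions that agree on the right half-plane agree off the spectra. -/
lemma transfer_eq_of_forall_re_pos {k : ℕ} {A : Matrix (Fin r) (Fin r) ℂ}
    {B : Matrix (Fin r) (Fin m) ℂ} {C : Matrix (Fin p) (Fin r) ℂ}
    {A' : Matrix (Fin k) (Fin k) ℂ} {B' : Matrix (Fin k) (Fin m) ℂ}
    {C' : Matrix (Fin p) (Fin k) ℂ}
    (h : ∀ s : ℂ, 0 < s.re → s ∉ spectrum ℂ A → s ∉ spectrum ℂ A' →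
      transfer A' B' C' s = transfer A B C s) {s : ℂ}
    (hs : s ∉ spectrum ℂ A) (hs' : s ∉ spectrum ℂ A') :
    transfer A' B' C' s = transfer A B C s := by
  set S := spectrum ℂ A ∪ spectrum ℂ A' with hS
  have hfin : S.Finite := (Matrix.finite_spectrum A).union (Matrix.finite_spectrum A')
  have hopen : IsOpen Sᶜ := hfin.isClosed.isOpen_compl
  have hpre : IsPreconnected Sᶜ :=
    (hfin.countable.isConnected_compl_of_one_lt_rank (by simp)).isPreconnected
  have hf : AnalyticOnNhd ℂ (fun s => vec (transfer A B C s)) Sᶜ :=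
    DifferentiableOn.analyticOnNhd (fun z hz => (differentiableAt_vec_transfer fun h' =>
      hz (Or.inl h')).differentiableWithinAt) hopen
  have hg : AnalyticOnNhd ℂ (fun s => vec (transfer A' B' C' s)) Sᶜ :=
    DifferentiableOn.analyticOnNhd (fun z hz => (differentiableAt_vec_transfer fun h' =>
      hz (Or.inr h')).differentiableWithinAt) hopen
  have hH : IsOpen {z : ℂ | 0 < z.re} := isOpen_lt continuous_const Complex.continuous_re
  obtain ⟨z₀, hz₀, hz₀'⟩ : ∃ z₀ : ℂ, z₀ ∈ {z : ℂ | 0 < z.re} ∧ z₀ ∈ Sᶜ :=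
    (hfin.countable.dense_compl ℝ).inter_open_nonempty _ hH ⟨1, by simp⟩
  have heq := hg.eqOn_of_preconnected_of_eventuallyEq hf hpre hz₀' (by
    filter_upwards [hH.mem_nhds hz₀, hopen.mem_nhds hz₀'] with z h1 h2
    rw [h z h1 (fun h' => h2 (Or.inl h')) fun h' => h2 (Or.inr h')])
  exact vec_injective (heq (show s ∈ Sᶜ from fun h' => h'.elim hs hs'))

end Transfer

/-! ### Loewner matrices -/

section Loewner

variable {r m p n : ℕ}

/-- The Loewner matrix of `R` at the points `μ i` and `σ j` in the directions `u` and `v`. -/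
def loewner (R : ℂ → Matrix (Fin p) (Fin m) ℂ) (u : Fin p → ℂ) (v : Fin m → ℂ) (μ σ : Fin n → ℂ) :
    Matrix (Fin n) (Fin n) ℂ :=
  Matrix.of fun i j => (μ i - σ j)⁻¹ * (u ⬝ᵥ R (σ j) *ᵥ v - u ⬝ᵥ R (μ i) *ᵥ v)

/-- The shifted Loewner matrix. -/
def loewnerShift (R : ℂ → Matrix (Fin p) (Fin m) ℂ) (u : Fin p → ℂ) (v : Fin m → ℂ)
    (μ σ : Fin n → ℂ) : Matrix (Fin n) (Fin n) ℂ :=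
  Matrix.of fun i j => σ j * loewner R u v μ σ i j - u ⬝ᵥ R (μ i) *ᵥ v

/-- The values of `R` at the points `μ i`, evaluated in direction `u` from the left. -/
def leftValues (R : ℂ → Matrix (Fin p) (Fin m) ℂ) (u : Fin p → ℂ) (μ : Fin n → ℂ) :
    Matrix (Fin n) (Fin m) ℂ :=
  Matrix.of fun i => u ᵥ* R (μ i)

/-- The values of `R` at the points `σ j`, evaluated in direction `v` from the right. -/
def rightValues (R : ℂ → Matrix (Fin p) (Fin m) ℂ) (v : Fin m → ℂ) (σ : Fin n → ℂ) :
    Matrix (Fin p) (Fin n) ℂ :=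
  Matrix.of fun a j => (R (σ j) *ᵥ v) a

/-- The tangential observability matrix. -/
def obsMatrix (A : Matrix (Fin r) (Fin r) ℂ) (C : Matrix (Fin p) (Fin r) ℂ) (u : Fin p → ℂ)
    (μ : Fin n → ℂ) : Matrix (Fin n) (Fin r) ℂ :=
  Matrix.of fun i => (u ᵥ* C) ᵥ* (μ i • (1 : Matrix (Fin r) (Fin r) ℂ) - A)⁻¹

/-- The tangential controllability matrix. -/
def ctrMatrix (A : Matrix (Fin r) (Fin r) ℂ) (B : Matrix (Fin r) (Fin m) ℂ) (v : Fin m → ℂ)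
    (σ : Fin n → ℂ) : Matrix (Fin r) (Fin n) ℂ :=
  Matrix.of fun l j => ((σ j • (1 : Matrix (Fin r) (Fin r) ℂ) - A)⁻¹ *ᵥ (B *ᵥ v)) l

variable {A : Matrix (Fin r) (Fin r) ℂ} {B : Matrix (Fin r) (Fin m) ℂ}
  {C : Matrix (Fin p) (Fin r) ℂ} {R : ℂ → Matrix (Fin p) (Fin m) ℂ} {u : Fin p → ℂ}
  {v : Fin m → ℂ} {μ σ : Fin n → ℂ}

lemma resolvent_mul_resolvent {a b : ℂ} (ha : a ∉ spectrum ℂ A) (hb : b ∉ spectrum ℂ A)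
    (hab : a ≠ b) :
    (a • (1 : Matrix (Fin r) (Fin r) ℂ) - A)⁻¹ * (b • (1 : Matrix (Fin r) (Fin r) ℂ) - A)⁻¹ =
      (a - b)⁻¹ • ((b • (1 : Matrix (Fin r) (Fin r) ℂ) - A)⁻¹ -
        (a • (1 : Matrix (Fin r) (Fin r) ℂ) - A)⁻¹) := by
  set X := a • (1 : Matrix (Fin r) (Fin r) ℂ) - A with hX
  set Y := b • (1 : Matrix (Fin r) (Fin r) ℂ) - A with hY
  have h1 : X⁻¹ * X = 1 := Matrix.nonsing_inv_mul _ (isUnit_det_smul_one_sub ha)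
  have h2 : Y * Y⁻¹ = 1 := Matrix.mul_nonsing_inv _ (isUnit_det_smul_one_sub hb)
  have h3 : X - Y = (a - b) • (1 : Matrix (Fin r) (Fin r) ℂ) := by
    rw [hX, hY, sub_smul]; abel
  have h4 : Y⁻¹ - X⁻¹ = X⁻¹ * (X - Y) * Y⁻¹ := by
    rw [mul_sub, sub_mul, h1, one_mul, mul_assoc, h2, mul_one]
  rw [h4, h3, Matrix.mul_smul, Matrix.smul_mul, mul_one, smul_smul,
    inv_mul_cancel₀ (sub_ne_zero.2 hab), one_smul]

lemma dotProduct_transfer (s : ℂ) : u ⬝ᵥ transfer A B C s *ᵥ v =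
    (u ᵥ* C) ⬝ᵥ (s • (1 : Matrix (Fin r) (Fin r) ℂ) - A)⁻¹ *ᵥ (B *ᵥ v) := by
  rw [transfer, ← Matrix.mulVec_mulVec, ← Matrix.mulVec_mulVec, Matrix.dotProduct_mulVec]

lemma obsMatrix_mul_ctrMatrix (hR : ∀ i, R (μ i) = transfer A B C (μ i))
    (hR' : ∀ j, R (σ j) = transfer A B C (σ j)) (hμ : ∀ i, μ i ∉ spectrum ℂ A)
    (hσ : ∀ j, σ j ∉ spectrum ℂ A) (hμσ : ∀ i j, μ i ≠ σ j) :
    obsMatrix A C u μ * ctrMatrix A B v σ = loewner R u v μ σ := by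
  ext i j
  have h1 : (obsMatrix A C u μ * ctrMatrix A B v σ) i j = (u ᵥ* C) ⬝ᵥ
      ((μ i • (1 : Matrix (Fin r) (Fin r) ℂ) - A)⁻¹ *
        (σ j • (1 : Matrix (Fin r) (Fin r) ℂ) - A)⁻¹) *ᵥ (B *ᵥ v) := by
    rw [← Matrix.mulVec_mulVec, Matrix.dotProduct_mulVec]
    rfl
  rw [h1, resolvent_mul_resolvent (hμ i) (hσ j) (hμσ i j), Matrix.smul_mulVec,
    Matrix.sub_mulVec, dotProduct_smul, dotProduct_sub, ← dotProduct_transfer,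
    ← dotProduct_transfer, ← hR, ← hR', smul_eq_mul]
  rfl

lemma obsMatrix_mul_mul_ctrMatrix (hR : ∀ i, R (μ i) = transfer A B C (μ i))
    (hR' : ∀ j, R (σ j) = transfer A B C (σ j)) (hμ : ∀ i, μ i ∉ spectrum ℂ A)
    (hσ : ∀ j, σ j ∉ spectrum ℂ A) (hμσ : ∀ i j, μ i ≠ σ j) :
    obsMatrix A C u μ * A * ctrMatrix A B v σ = loewnerShift R u v μ σ := by
  have hL := obsMatrix_mul_ctrMatrix (u := u) (v := v) hR hR' hμ hσ hμσ
  ext i j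
  have h0 : A * (σ j • (1 : Matrix (Fin r) (Fin r) ℂ) - A)⁻¹ =
      σ j • (σ j • (1 : Matrix (Fin r) (Fin r) ℂ) - A)⁻¹ - 1 := by
    have h2 := Matrix.mul_nonsing_inv _ (isUnit_det_smul_one_sub (hσ j))
    rw [sub_mul, Matrix.smul_mul, one_mul] at h2
    rw [eq_sub_iff_add_eq, ← sub_eq_iff_eq_add'.1 h2]
  have h1 : (obsMatrix A C u μ * A * ctrMatrix A B v σ) i j =
      (obsMatrix A C u μ i) ⬝ᵥ (A * (σ j • (1 : Matrix (Fin r) (Fin r) ℂ) - A)⁻¹) *ᵥ (B *ᵥ v) := by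
    rw [Matrix.mul_assoc, ← Matrix.mulVec_mulVec]
    rfl
  have h2 : obsMatrix A C u μ i ⬝ᵥ (σ j • (1 : Matrix (Fin r) (Fin r) ℂ) - A)⁻¹ *ᵥ (B *ᵥ v) =
      loewner R u v μ σ i j := by
    rw [← hL]; rfl
  have h3 : obsMatrix A C u μ i ⬝ᵥ B *ᵥ v = u ⬝ᵥ R (μ i) *ᵥ v := by
    rw [hR, dotProduct_transfer, Matrix.dotProduct_mulVec (u ᵥ* C)]
    rfl
  rw [h1, h0, Matrix.sub_mulVec, Matrix.smul_mulVec, dotProduct_sub, dotProduct_smul, h2,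
    Matrix.one_mulVec, h3]
  rfl

lemma obsMatrix_mul (hR : ∀ i, R (μ i) = transfer A B C (μ i)) :
    obsMatrix A C u μ * B = leftValues R u μ := by
  ext i j
  have : (obsMatrix A C u μ * B) i j =
      (((u ᵥ* C) ᵥ* (μ i • (1 : Matrix (Fin r) (Fin r) ℂ) - A)⁻¹) ᵥ* B) j := rfl
  rw [this, Matrix.vecMul_vecMul, Matrix.vecMul_vecMul, ← Matrix.mul_assoc]
  change (u ᵥ* transfer A B C (μ i)) j = _
  rw [← hR]
  rfl

lemma mul_ctrMatrix (hR' : ∀ j, R (σ j) = transfer A B C (σ j)) :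
    C * ctrMatrix A B v σ = rightValues R v σ := by
  ext i j
  have : (C * ctrMatrix A B v σ) i j =
      (C *ᵥ ((σ j • (1 : Matrix (Fin r) (Fin r) ℂ) - A)⁻¹ *ᵥ (B *ᵥ v))) i := rfl
  rw [this, Matrix.mulVec_mulVec, Matrix.mulVec_mulVec]
  change (transfer A B C (σ j) *ᵥ v) i = _
  rw [← hR']
  rfl

/-- The Loewner pencil in terms of a realization. -/
lemma loewnerPencil_eq (hR : ∀ i, R (μ i) = transfer A B C (μ i))
    (hR' : ∀ j, R (σ j) = transfer A B C (σ j)) (hμ : ∀ i, μ i ∉ spectrum ℂ A)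
    (hσ : ∀ j, σ j ∉ spectrum ℂ A) (hμσ : ∀ i j, μ i ≠ σ j) (s : ℂ) :
    s • loewner R u v μ σ - loewnerShift R u v μ σ =
      obsMatrix A C u μ * (s • (1 : Matrix (Fin r) (Fin r) ℂ) - A) * ctrMatrix A B v σ := by
  rw [← obsMatrix_mul_ctrMatrix (u := u) (v := v) hR hR' hμ hσ hμσ,
    ← obsMatrix_mul_mul_ctrMatrix (u := u) (v := v) hR hR' hμ hσ hμσ, Matrix.mul_sub,
    Matrix.sub_mul, Matrix.mul_smul, Matrix.smul_mul, Matrix.mul_one]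

end Loewner

section LoewnerSquare

variable {r m p : ℕ} {A : Matrix (Fin r) (Fin r) ℂ} {B : Matrix (Fin r) (Fin m) ℂ}
  {C : Matrix (Fin p) (Fin r) ℂ} {R : ℂ → Matrix (Fin p) (Fin m) ℂ} {u : Fin p → ℂ}
  {v : Fin m → ℂ} {μ σ : Fin r → ℂ}

/-- A transfer function is recovered from its Loewner pencil. -/
theorem transfer_eq_loewner (hR : ∀ i, R (μ i) = transfer A B C (μ i))
    (hR' : ∀ j, R (σ j) = transfer A B C (σ j)) (hμ : ∀ i, μ i ∉ spectrum ℂ A)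
    (hσ : ∀ j, σ j ∉ spectrum ℂ A) (hμσ : ∀ i j, μ i ≠ σ j)
    (hdet : (loewner R u v μ σ).det ≠ 0) (s : ℂ) :
    transfer A B C s = rightValues R v σ *
      (s • loewner R u v μ σ - loewnerShift R u v μ σ)⁻¹ * leftValues R u μ := by
  rw [← obsMatrix_mul_ctrMatrix (u := u) (v := v) hR hR' hμ hσ hμσ, Matrix.det_mul] at hdet
  have hO : IsUnit (obsMatrix A C u μ).det := (left_ne_zero_of_mul hdet).isUnit
  have hQ : IsUnit (ctrMatrix A B v σ).det := (right_ne_zero_of_mul hdet).isUnit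
  rw [loewnerPencil_eq hR hR' hμ hσ hμσ, ← obsMatrix_mul hR, ← mul_ctrMatrix hR',
    Matrix.mul_inv_rev, Matrix.mul_inv_rev, transfer]
  simp only [Matrix.mul_assoc]
  rw [Matrix.nonsing_inv_mul_cancel_left _ _ hO, Matrix.mul_nonsing_inv_cancel_left _ _ hQ]

end LoewnerSquare

/-! ### Pole-residue forms -/

section PoleResidue

variable {r m p n : ℕ}

/-- The function `s ↦ ∑ c_k b_k^* / (s - λ_k)`. -/
def poleResidue (lam : Fin r → ℂ) (b : Fin r → Fin m → ℂ) (c : Fin r → Fin p → ℂ) :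
    ℂ → Matrix (Fin p) (Fin m) ℂ :=
  ∑ k, pole (lam k) (Matrix.vecMulVec (c k) (star (b k)))

/-- The input matrix of a diagonal realization. -/
def inputMatrix (b : Fin r → Fin m → ℂ) : Matrix (Fin r) (Fin m) ℂ :=
  Matrix.of fun k => star (b k)

/-- The output matrix of a diagonal realization. -/
def outputMatrix (c : Fin r → Fin p → ℂ) : Matrix (Fin p) (Fin r) ℂ :=
  (Matrix.of c)ᵀ

variable {lam : Fin r → ℂ} {b : Fin r → Fin m → ℂ} {c : Fin r → Fin p → ℂ}

lemma inv_smul_one_sub_diagonal {s : ℂ} (hs : s ∉ Set.range lam) :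
    (s • (1 : Matrix (Fin r) (Fin r) ℂ) - Matrix.diagonal lam)⁻¹ =
      Matrix.diagonal fun k => (s - lam k)⁻¹ := by
  refine Matrix.inv_eq_right_inv ?_
  rw [Matrix.smul_one_eq_diagonal, Matrix.diagonal_sub, Matrix.diagonal_mul_diagonal,
    ← Matrix.diagonal_one]
  congr 1
  funext k
  exact mul_inv_cancel₀ (sub_ne_zero.2 fun h => hs ⟨k, h.symm⟩)

lemma poleResidue_eq_transfer {s : ℂ} (hs : s ∉ Set.range lam) :
    poleResidue lam b c s =
      transfer (Matrix.diagonal lam) (inputMatrix b) (outputMatrix c) s := by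
  rw [transfer, inv_smul_one_sub_diagonal hs]
  ext i j
  rw [Matrix.mul_apply, poleResidue, Finset.sum_apply, Matrix.sum_apply]
  refine Finset.sum_congr rfl fun k _ => ?_
  rw [Matrix.mul_diagonal]
  simp only [pole, Matrix.smul_apply, Matrix.vecMulVec_apply, outputMatrix, inputMatrix,
    Matrix.transpose_apply, Matrix.of_apply, smul_eq_mul]
  ring

/-- Cauchy-like matrices are nonsingular. -/
lemma det_cauchy_ne_zero {μ lam a : Fin r → ℂ} (hμ : Function.Injective μ)
    (hlam : Function.Injective lam) (ha : ∀ k, a k ≠ 0) (hne : ∀ i k, μ i ≠ lam k) :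
    (Matrix.of fun i k => a k * (μ i - lam k)⁻¹).det ≠ 0 := by
  intro hdet
  obtain ⟨x, hx0, hx⟩ := Matrix.exists_mulVec_eq_zero_iff.2 hdet
  apply hx0
  set P : Polynomial ℂ := ∑ k, Polynomial.C (a k * x k) *
    ∏ l ∈ Finset.univ.erase k, (Polynomial.X - Polynomial.C (lam l)) with hP
  have hdeg : P.degree < r := by
    rw [Polynomial.degree_lt_iff_coeff_zero]
    intro d hd
    rw [hP, Polynomial.finsetSum_coeff]
    refine Finset.sum_eq_zero fun k _ => ?_
    rw [Polynomial.coeff_C_mul, Polynomial.coeff_eq_zero_of_natDegree_lt, mul_zero]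
    rw [Polynomial.natDegree_finsetProd_X_sub_C_eq_card, Finset.card_erase_of_mem (Finset.mem_univ k),
      Finset.card_univ, Fintype.card_fin]
    have := k.pos
    omega
  have heval : ∀ i, P.eval (μ i) = 0 := by
    intro i
    have h1 := congrFun hx i
    have h2 : P.eval (μ i) = (∏ l, (μ i - lam l)) * ∑ k, a k * (μ i - lam k)⁻¹ * x k := by
      rw [hP, Polynomial.eval_finsetSum, Finset.mul_sum]
      refine Finset.sum_congr rfl fun k _ => ?_
      rw [← Finset.mul_prod_erase Finset.univ _ (Finset.mem_univ k), Polynomial.eval_mul,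
        Polynomial.eval_C, Polynomial.eval_prod]
      simp only [Polynomial.eval_sub, Polynomial.eval_X, Polynomial.eval_C]
      have := sub_ne_zero.2 (hne i k)
      field_simp
    rw [h2]
    have h3 : ∑ k, a k * (μ i - lam k)⁻¹ * x k = 0 := h1
    rw [h3, mul_zero]
  have hP0 : P = 0 :=
    Polynomial.eq_zero_of_degree_lt_of_eval_index_eq_zero Finset.univ
      (v := μ) hμ.injOn (by simpa using hdeg) fun i _ => heval i
  funext k
  have h4 : P.eval (lam k) = a k * x k * ∏ l ∈ Finset.univ.erase k, (lam k - lam l) := by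
    rw [hP, Polynomial.eval_finsetSum, Finset.sum_eq_single k]
    · rw [Polynomial.eval_mul, Polynomial.eval_C, Polynomial.eval_prod]
      simp
    · intro l _ hl
      rw [Polynomial.eval_mul, Polynomial.eval_prod,
        Finset.prod_eq_zero (Finset.mem_erase.2 ⟨hl.symm, Finset.mem_univ k⟩) (by simp), mul_zero]
    · simp
  rw [hP0, Polynomial.eval_zero] at h4
  have h5 : ∏ l ∈ Finset.univ.erase k, (lam k - lam l) ≠ 0 :=
    Finset.prod_ne_zero_iff.2 fun l hl =>
      sub_ne_zero.2 fun h => (Finset.ne_of_mem_erase hl) (hlam h).symm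
  have h6 := (mul_eq_zero.1 h4.symm).resolve_right h5
  exact (mul_eq_zero.1 h6).resolve_left (ha k)

lemma exists_forall_dotProduct_ne_zero (w : Fin r → Fin n → ℂ) (hw : ∀ k, w k ≠ 0) :
    ∃ u : Fin n → ℂ, ∀ k, u ⬝ᵥ w k ≠ 0 := by
  obtain ⟨f, hf⟩ := Module.exists_dual_forall_apply_ne_zero (K := ℂ) w hw
  refine ⟨fun i => f (Pi.single i 1), fun k => ?_⟩
  convert hf k using 1
  rw [LinearMap.pi_apply_eq_sum_univ f (w k), dotProduct]
  refine Finset.sum_congr rfl fun i _ => ?_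
  rw [smul_eq_mul, mul_comm]
  congr 2
  funext j
  simp [Pi.single_apply, eq_comm]

lemma obsMatrix_diagonal {u : Fin p → ℂ} {μ : Fin n → ℂ} (hμ : ∀ i, μ i ∉ Set.range lam) :
    obsMatrix (Matrix.diagonal lam) (outputMatrix c) u μ =
      Matrix.of fun i k => (u ⬝ᵥ c k) * (μ i - lam k)⁻¹ := by
  ext i k
  rw [obsMatrix, Matrix.of_apply, inv_smul_one_sub_diagonal (hμ i), Matrix.vecMul_diagonal]
  rfl

lemma ctrMatrix_diagonal {v : Fin m → ℂ} {σ : Fin n → ℂ} (hσ : ∀ i, σ i ∉ Set.range lam) :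
    ctrMatrix (Matrix.diagonal lam) (inputMatrix b) v σ =
      (Matrix.of fun j k => (v ⬝ᵥ star (b k)) * (σ j - lam k)⁻¹)ᵀ := by
  ext k j
  rw [ctrMatrix, Matrix.of_apply, inv_smul_one_sub_diagonal (hσ j), Matrix.mulVec_diagonal,
    Matrix.transpose_apply, Matrix.of_apply, mul_comm, dotProduct_comm]
  rfl

/-- There are directions for which the diagonal realization of a pole-residue form with distinct
poles and nonzero residues has nonsingular tangential observability and controllability
matrices. -/
lemma exists_directions (hlam : Function.Injective lam) (hb : ∀ k, b k ≠ 0) (hc : ∀ k, c k ≠ 0) :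
    ∃ (u : Fin p → ℂ) (v : Fin m → ℂ), ∀ μ σ : Fin r → ℂ, Function.Injective μ →
      Function.Injective σ → (∀ i, μ i ∉ Set.range lam) → (∀ j, σ j ∉ Set.range lam) →
      (obsMatrix (Matrix.diagonal lam) (outputMatrix c) u μ).det ≠ 0 ∧
      (ctrMatrix (Matrix.diagonal lam) (inputMatrix b) v σ).det ≠ 0 := by
  obtain ⟨u, hu⟩ := exists_forall_dotProduct_ne_zero c hc
  obtain ⟨v, hv⟩ := exists_forall_dotProduct_ne_zero (fun k => star (b k))
    fun k => star_ne_zero.2 (hb k)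
  refine ⟨u, v, fun μ σ hμ hσ hμl hσl => ?_⟩
  rw [obsMatrix_diagonal hμl, ctrMatrix_diagonal hσl, Matrix.det_transpose]
  exact ⟨det_cauchy_ne_zero hμ hlam hu fun i k h => hμl i ⟨k, h.symm⟩,
    det_cauchy_ne_zero hσ hlam hv fun i k h => hσl i ⟨k, h.symm⟩⟩

/-- Pole-residue forms with distinct poles and nonzero residues are minimal. -/
theorem isMinimal_diagonal (hlam : Function.Injective lam) (hb : ∀ k, b k ≠ 0)
    (hc : ∀ k, c k ≠ 0) :
    IsMinimal (Matrix.diagonal lam) (inputMatrix b) (outputMatrix c) := by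
  intro k A' B' C' h
  obtain ⟨u, v, huv⟩ := exists_directions hlam hb hc
  have hfin : (Set.range lam ∪ spectrum ℂ A').Finite :=
    (Set.finite_range lam).union (Matrix.finite_spectrum A')
  set e := hfin.infinite_compl.natEmbedding with he
  have hel : ∀ i, (e i : ℂ) ∉ Set.range lam := fun i h' => (e i).2 (Or.inl h')
  have heA : ∀ i, (e i : ℂ) ∉ spectrum ℂ A' := fun i h' => (e i).2 (Or.inr h')
  have hinj : ∀ {i j : ℕ}, (e i : ℂ) = e j → i = j := fun h' => e.injective (Subtype.ext h')
  set μ : Fin r → ℂ := fun i => e i with hμ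
  set σ : Fin r → ℂ := fun j => e (r + j) with hσ
  have hμσ : ∀ i j, μ i ≠ σ j := fun i j h' => by
    have := hinj h'
    have := i.2
    omega
  obtain ⟨h1, h2⟩ := huv μ σ (fun i j h' => Fin.ext (hinj h'))
    (fun i j h' => Fin.ext (by have := hinj h'; omega)) (fun i => hel _) fun j => hel _
  have hspec : spectrum ℂ (Matrix.diagonal lam) = Set.range lam := spectrum_diagonal lam
  have hL := obsMatrix_mul_ctrMatrix (u := u) (v := v)
    (R := transfer (Matrix.diagonal lam) (inputMatrix b) (outputMatrix c)) (μ := μ) (σ := σ)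
    (fun i => rfl) (fun j => rfl) (fun i => by rw [hspec]; exact hel _)
    (fun j => by rw [hspec]; exact hel _) hμσ
  have hL' := obsMatrix_mul_ctrMatrix (u := u) (v := v)
    (R := transfer (Matrix.diagonal lam) (inputMatrix b) (outputMatrix c)) (μ := μ) (σ := σ)
    (fun i => (h _ (by rw [hspec]; exact hel _) (heA _)).symm)
    (fun j => (h _ (by rw [hspec]; exact hel _) (heA _)).symm)
    (fun i => heA _) (fun j => heA _) hμσ
  have hunit : IsUnit (obsMatrix A' C' u μ * ctrMatrix A' B' v σ) := by
    rw [hL', ← hL, Matrix.isUnit_iff_isUnit_det, Matrix.det_mul]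
    exact (mul_ne_zero h1 h2).isUnit
  have hrank := Matrix.rank_of_isUnit _ hunit
  rw [Fintype.card_fin] at hrank
  rw [← hrank]
  exact (Matrix.rank_mul_le_left _ _).trans (Matrix.rank_le_width _)

lemma poleResidue_mem_stableRational (hlam : Function.Injective lam) (hre : ∀ k, (lam k).re < 0)
    (hb : ∀ k, b k ≠ 0) (hc : ∀ k, c k ≠ 0) : poleResidue lam b c ∈ StableRational r m p := by
  refine ⟨_, _, _, ?_, isMinimal_diagonal hlam hb hc, fun s hs => poleResidue_eq_transfer ?_⟩
  · intro μ hμ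
    rw [spectrum_diagonal] at hμ
    obtain ⟨k, rfl⟩ := hμ
    exact hre k
  · rintro ⟨k, rfl⟩
    exact lt_asymm (hre k) hs

/-- In a pole-residue form of a stable rational function of the same order, all residues are
nonzero. -/
lemma vecMulVec_ne_zero_of_mem_stableRational {F : ℂ → Matrix (Fin p) (Fin m) ℂ}
    (hF : F ∈ StableRational r m p) (hform : ∀ s : ℂ, 0 < s.re → F s = poleResidue lam b c s)
    (k : Fin r) : Matrix.vecMulVec (c k) (star (b k)) ≠ 0 := by
  intro h0
  obtain ⟨A, B, C, hA, hmin, hF⟩ := hF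
  obtain _ | n := r
  · exact k.elim0
  have hP : poleResidue lam b c = poleResidue (lam ∘ k.succAbove) (b ∘ k.succAbove)
      (c ∘ k.succAbove) := by
    rw [poleResidue, Fin.sum_univ_succAbove _ k, h0]
    have : pole (lam k) (0 : Matrix (Fin p) (Fin m) ℂ) = 0 := funext fun _ => smul_zero _
    rw [this, zero_add]
    rfl
  have := hmin n (Matrix.diagonal (lam ∘ k.succAbove)) (inputMatrix (b ∘ k.succAbove))
    (outputMatrix (c ∘ k.succAbove)) fun s hs hs' => transfer_eq_of_forall_re_pos
      (fun z hz _ hz' => ?_) hs hs'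
  · omega
  · rw [spectrum_diagonal] at hz'
    rw [← poleResidue_eq_transfer hz', ← hP, ← hform z hz, hF z hz]

/-- The poles in a pole-residue form of a stable rational function lie in the left half-plane. -/
lemma re_neg_of_mem_stableRational {F : ℂ → Matrix (Fin p) (Fin m) ℂ}
    (hF : F ∈ StableRational r m p) (hlam : Function.Injective lam)
    (hform : ∀ s : ℂ, 0 < s.re → F s = poleResidue lam b c s)
    (k : Fin r) : (lam k).re < 0 := by
  have hne := vecMulVec_ne_zero_of_mem_stableRational hF hform k
  obtain ⟨A, B, C, hA, hmin, hF⟩ := hF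
  by_contra hk
  have hkA : lam k ∉ spectrum ℂ A := fun h => hk (hA _ h)
  apply hne
  apply vec_injective
  set T : ℂ → FrobSpace p m := fun s => vec (transfer A B C s) with hT
  set Q : ℂ → FrobSpace p m := fun s => ∑ l ∈ Finset.univ.erase k,
    (s - lam l)⁻¹ • vec (Matrix.vecMulVec (c l) (star (b l))) with hQ
  have hvecsum : ∀ s, vec (poleResidue lam b c s) =
      (s - lam k)⁻¹ • vec (Matrix.vecMulVec (c k) (star (b k))) + Q s := by
    intro s
    have h1 : vec (poleResidue lam b c s) =
        ∑ l, (s - lam l)⁻¹ • vec (Matrix.vecMulVec (c l) (star (b l))) := by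
      ext ij
      rw [vec_apply, poleResidue, Finset.sum_apply, Matrix.sum_apply, WithLp.ofLp_sum,
        Finset.sum_apply]
      rfl
    rw [h1, ← Finset.add_sum_erase _ _ (Finset.mem_univ k)]
  have hTc : ContinuousAt T (lam k) := (differentiableAt_vec_transfer hkA).continuousAt
  have hQc : ContinuousAt Q (lam k) := by
    refine tendsto_finsetSum _ fun l hl => ?_
    have : lam k - lam l ≠ 0 :=
      sub_ne_zero.2 fun h => (Finset.ne_of_mem_erase hl) (hlam h).symm
    have h2 : ContinuousAt (fun s : ℂ => (s - lam l)⁻¹) (lam k) :=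
      (continuousAt_id.sub continuousAt_const).inv₀ this
    exact Tendsto.smul_const h2 _
  have hlim : Tendsto (fun s => (s - lam k) • (T s - Q s)) (𝓝[≠] lam k) (𝓝 0) := by
    have h1 : Tendsto (fun s => (s - lam k) • (T s - Q s)) (𝓝 (lam k))
        (𝓝 ((lam k - lam k) • (T (lam k) - Q (lam k)))) :=
      (tendsto_id.sub_const (lam k)).smul (hTc.sub hQc)
    rw [sub_self, zero_smul] at h1
    exact h1.mono_left nhdsWithin_le_nhds
  refine tendsto_nhds_unique (Tendsto.congr' ?_ tendsto_const_nhds) hlim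
  have hfin : ((spectrum ℂ A ∪ Set.range lam) \ {lam k}).Finite :=
    ((Matrix.finite_spectrum A).union (Set.finite_range lam)).sdiff
  have hev : ∀ᶠ s in 𝓝 (lam k), s ∉ (spectrum ℂ A ∪ Set.range lam) \ {lam k} :=
    hfin.isClosed.isOpen_compl.mem_nhds fun h => h.2 rfl
  filter_upwards [nhdsWithin_le_nhds hev, self_mem_nhdsWithin] with s h1 h2
  have hsA : s ∉ spectrum ℂ A := fun h => h1 ⟨Or.inl h, h2⟩
  have hsl : s ∉ Set.range lam := fun h => h1 ⟨Or.inr h, h2⟩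
  have heq : transfer (Matrix.diagonal lam) (inputMatrix b) (outputMatrix c) s =
      transfer A B C s := by
    refine transfer_eq_of_forall_re_pos (fun z hz _ hz' => ?_) hsA
      (by rwa [spectrum_diagonal])
    rw [spectrum_diagonal] at hz'
    rw [← poleResidue_eq_transfer hz', ← hform z hz, hF z hz]
  rw [hT]
  simp only
  rw [← heq, ← poleResidue_eq_transfer hsl, hvecsum, add_sub_cancel_right, smul_smul,
    mul_inv_cancel₀ (sub_ne_zero.2 h2), one_smul]

end PoleResidue

/-! ### Entrywise derivatives of matrix-valued curves -/

section MatrixCurves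

attribute [local instance] Matrix.linftyOpNormedRing Matrix.linftyOpNormedAlgebra

variable {k l n : ℕ}

lemma hasDerivAt_matrix_mul {X : ℝ → Matrix (Fin k) (Fin l) ℂ} {X' : Matrix (Fin k) (Fin l) ℂ}
    {Y : ℝ → Matrix (Fin l) (Fin n) ℂ} {Y' : Matrix (Fin l) (Fin n) ℂ} {t : ℝ}
    (hX : ∀ i j, HasDerivAt (fun t => X t i j) (X' i j) t)
    (hY : ∀ i j, HasDerivAt (fun t => Y t i j) (Y' i j) t) (i : Fin k) (j : Fin n) :
    HasDerivAt (fun t => (X t * Y t) i j) ((X' * Y t + X t * Y') i j) t := by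
  simp only [Matrix.mul_apply, Matrix.add_apply]
  rw [← Finset.sum_add_distrib]
  exact HasDerivAt.fun_sum fun a _ => (hX i a).mul (hY a j)

lemma hasDerivAt_linearMap_comp {V W : Type*} [NormedAddCommGroup V] [NormedSpace ℂ V]
    [NormedSpace ℝ V] [IsScalarTower ℝ ℂ V] [FiniteDimensional ℂ V]
    [NormedAddCommGroup W] [NormedSpace ℂ W] [NormedSpace ℝ W] [IsScalarTower ℝ ℂ W]
    (T : V →ₗ[ℂ] W) {f : ℝ → V} {f' : V} {t : ℝ}
    (hf : HasDerivAt f f' t) : HasDerivAt (fun t => T (f t)) (T f') t :=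
  (T.toContinuousLinearMap.restrictScalars ℝ).hasFDerivAt.comp_hasDerivAt t hf

lemma hasDerivAt_ringInverse_comp {R : Type*} [NormedRing R] [HasSummableGeomSeries R]
    [NormedAlgebra ℝ R] {f : ℝ → R} {f' : R} {t : ℝ} (hf : HasDerivAt f f' t)
    (hu : IsUnit (f t)) :
    HasDerivAt (fun t => Ring.inverse (f t))
      (-(Ring.inverse (f t) * f' * Ring.inverse (f t))) t := by
  obtain ⟨u, hu⟩ := hu
  have h := hasFDerivAt_ringInverse (𝕜 := ℝ) u
  rw [hu] at h
  have h2 := h.comp_hasDerivAt t hf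
  rw [← hu, Ring.inverse_unit]
  simpa using! h2

lemma hasDerivAt_matrix_inv {P : ℝ → Matrix (Fin n) (Fin n) ℂ} {P' : Matrix (Fin n) (Fin n) ℂ}
    {t : ℝ} (hP : ∀ i j, HasDerivAt (fun t => P t i j) (P' i j) t) (hdet : (P t).det ≠ 0)
    (i j : Fin n) :
    HasDerivAt (fun t => (P t)⁻¹ i j) ((-((P t)⁻¹ * P' * (P t)⁻¹)) i j) t := by
  have h1 : HasDerivAt P P' t := by
    have h2 : HasDerivAt (fun t => ∑ i, ∑ j, P t i j • Matrix.single i j (1 : ℂ))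
        (∑ i, ∑ j, P' i j • Matrix.single i j (1 : ℂ)) t :=
      HasDerivAt.fun_sum fun i _ => HasDerivAt.fun_sum fun j _ => (hP i j).smul_const _
    have h3 : ∀ M : Matrix (Fin n) (Fin n) ℂ, ∑ i, ∑ j, M i j • Matrix.single i j (1 : ℂ) = M := by
      intro M
      conv_rhs => rw [Matrix.matrix_eq_sum_single M]
      simp [Matrix.smul_single]
    simpa only [h3] using h2
  have h4 := hasDerivAt_ringInverse_comp h1
    ((Matrix.isUnit_iff_isUnit_det _).2 hdet.isUnit)
  simp only [← Matrix.nonsing_inv_eq_ringInverse] at h4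
  exact hasDerivAt_linearMap_comp (Matrix.entryLinearMap ℂ ℂ i j) h4

end MatrixCurves

/-! ### Tangent vectors -/

section Tangent

variable {r m p : ℕ}

/-- The velocity of a curve of pole-residue forms with velocities `x`, `y`, `ν` of `c`, `b` and
`lam`. -/
def tangentVector (lam : Fin r → ℂ) (b : Fin r → Fin m → ℂ) (c : Fin r → Fin p → ℂ)
    (x : Fin r → Fin p → ℂ) (y : Fin r → Fin m → ℂ) (ν : Fin r → ℂ) :
    ℂ → Matrix (Fin p) (Fin m) ℂ :=
  ∑ k, (ν k • doublePole (lam k) (Matrix.vecMulVec (c k) (star (b k))) +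
    pole (lam k) (Matrix.vecMulVec (x k) (star (b k)) + Matrix.vecMulVec (c k) (star (y k))))

variable {lam : Fin r → ℂ} {b : Fin r → Fin m → ℂ} {c : Fin r → Fin p → ℂ}
  {x : Fin r → Fin p → ℂ} {y : Fin r → Fin m → ℂ} {ν : Fin r → ℂ}

lemma memH2_tangentVector (hre : ∀ k, (lam k).re < 0) :
    MemH2 (tangentVector lam b c x y ν) :=
  MemH2.sum _ fun k _ => ((memH2_doublePole (hre k) _).smul _).add (memH2_pole (hre k) _)

lemma boundary_tangentVector (hre : ∀ k, (lam k).re < 0) :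
    boundary (tangentVector lam b c x y ν) =
      ∑ k, (ν k • boundary (doublePole (lam k) (Matrix.vecMulVec (c k) (star (b k)))) +
        boundary (pole (lam k) (Matrix.vecMulVec (x k) (star (b k)) +
          Matrix.vecMulVec (c k) (star (y k))))) := by
  rw [tangentVector, boundary_sum _ fun k _ =>
    ((memH2_doublePole (hre k) _).smul _).add (memH2_pole (hre k) _)]
  refine Finset.sum_congr rfl fun k _ => ?_
  rw [MemH2.boundary_add ((memH2_doublePole (hre k) _).smul _) (memH2_pole (hre k) _),
    (memH2_doublePole (hre k) _).boundary_smul]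

lemma vecMulVec_add_smul (t : ℝ) (c x : Fin p → ℂ) (b y : Fin m → ℂ) :
    Matrix.vecMulVec (c + (t : ℂ) • x) (star (b + (t : ℂ) • y)) =
      Matrix.vecMulVec c (star b) +
        (t : ℂ) • (Matrix.vecMulVec x (star b) + Matrix.vecMulVec c (star y)) +
        ((t : ℂ) ^ 2) • Matrix.vecMulVec x (star y) := by
  ext i j
  simp [Matrix.vecMulVec_apply]
  ring

lemma eventually_add_smul_ne_zero {E : Type*} [NormedAddCommGroup E] [NormedSpace ℂ E] {v : E}
    (hv : v ≠ 0) (w : E) : ∀ᶠ t : ℝ in 𝓝 0, v + (t : ℂ) • w ≠ 0 := by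
  have : Continuous fun t : ℝ => v + (t : ℂ) • w := by fun_prop
  exact this.tendsto 0 (isOpen_ne.mem_nhds (by simpa using hv))

/-- The tangent vectors of curves of pole-residue forms are tangent to the manifold of stable
rational functions. -/
theorem tangentVector_mem_tangentSpace {F : ℂ → Matrix (Fin p) (Fin m) ℂ}
    (hlam : Function.Injective lam) (hre : ∀ k, (lam k).re < 0) (hb : ∀ k, b k ≠ 0)
    (hc : ∀ k, c k ≠ 0) (hF : ∀ s : ℂ, 0 < s.re → F s = poleResidue lam b c s)
    (x : Fin r → Fin p → ℂ) (y : Fin r → Fin m → ℂ) (ν : Fin r → ℂ) :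
    tangentVector lam b c x y ν ∈ tangentSpace r m p F := by
  set γ : ℝ → ℂ → Matrix (Fin p) (Fin m) ℂ := fun t => poleResidue
    (fun k => lam k + t * ν k) (fun k => b k + (t : ℂ) • y k) (fun k => c k + (t : ℂ) • x k) with hγ
  have hsmooth := fun k => eventually_contDiffAt_boundary_pole (hre k) (ν k)
    (Matrix.vecMulVec (c k) (star (b k)))
    (Matrix.vecMulVec (x k) (star (b k)) + Matrix.vecMulVec (c k) (star (y k)))
    (Matrix.vecMulVec (x k) (star (y k)))
  have hevre : ∀ᶠ t : ℝ in 𝓝 0, ∀ k, (lam k + t * ν k).re < 0 :=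
    eventually_all.2 fun k => (hsmooth k).1.mono fun t ht => ht.1
  have hevinj : ∀ᶠ t : ℝ in 𝓝 0, Function.Injective fun k => lam k + t * ν k := by
    have h1 : ∀ᶠ t : ℝ in 𝓝 0, ∀ k l, k ≠ l → lam k + t * ν k ≠ lam l + t * ν l := by
      refine eventually_all.2 fun k => eventually_all.2 fun l => ?_
      by_cases hkl : k = l
      · exact Eventually.of_forall fun t h => absurd hkl h
      · have := eventually_add_smul_ne_zero
          (sub_ne_zero.2 fun h => hkl (hlam h) : lam k - lam l ≠ 0) (ν k - ν l)
        filter_upwards [this] with t ht _ h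
        apply ht
        rw [smul_eq_mul]
        linear_combination h
    filter_upwards [h1] with t ht k l h
    by_contra hkl
    exact ht k l hkl h
  have hevb : ∀ᶠ t : ℝ in 𝓝 0, ∀ k, b k + (t : ℂ) • y k ≠ 0 :=
    eventually_all.2 fun k => eventually_add_smul_ne_zero (hb k) (y k)
  have hevc : ∀ᶠ t : ℝ in 𝓝 0, ∀ k, c k + (t : ℂ) • x k ≠ 0 :=
    eventually_all.2 fun k => eventually_add_smul_ne_zero (hc k) (x k)
  have hbd : ∀ᶠ t : ℝ in 𝓝 0, boundary (γ t) = ∑ k, boundary (pole (lam k + t * ν k)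
      (Matrix.vecMulVec (c k) (star (b k)) + (t : ℂ) •
        (Matrix.vecMulVec (x k) (star (b k)) + Matrix.vecMulVec (c k) (star (y k))) +
        ((t : ℂ) ^ 2) • Matrix.vecMulVec (x k) (star (y k)))) := by
    filter_upwards [hevre] with t ht
    rw [hγ]
    simp only [poleResidue]
    rw [boundary_sum _ fun k _ => memH2_pole (ht k) _]
    simp_rw [vecMulVec_add_smul]
  have hcd : ∀ᶠ t : ℝ in 𝓝 0, ContDiffAt ℝ ∞ (fun t => boundary (γ t)) t := by
    have h1 : ∀ᶠ t : ℝ in 𝓝 0, ∀ k, ContDiffAt ℝ ∞ (fun t : ℝ => boundary (pole (lam k + t * ν k)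
        (Matrix.vecMulVec (c k) (star (b k)) + (t : ℂ) •
        (Matrix.vecMulVec (x k) (star (b k)) + Matrix.vecMulVec (c k) (star (y k))) +
        ((t : ℂ) ^ 2) • Matrix.vecMulVec (x k) (star (y k))))) t :=
      eventually_all.2 fun k => (hsmooth k).1.mono fun t ht => ht.2
    filter_upwards [h1, eventually_eventually_nhds.2 hbd] with t h2 h3
    exact (ContDiffAt.sum fun k _ => h2 k).congr_of_eventuallyEq h3
  obtain ⟨ε, hε, hball⟩ := Metric.eventually_nhds_iff_ball.1
    (hevre.and (hevinj.and (hevb.and (hevc.and hcd))))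
  rw [Real.ball_eq_Ioo, zero_sub, zero_add] at hball
  refine ⟨memH2_tangentVector hre, ε, γ, hε, fun t ht => ?_, fun t ht => ?_, fun s hs => ?_, ?_⟩
  · obtain ⟨h1, h2, h3, h4, -⟩ := hball t ht
    exact poleResidue_mem_stableRational h2 h1 h3 h4
  · exact (hball t ht).2.2.2.2.contDiffWithinAt
  · rw [hF s hs]
    simp [hγ]
  · rw [boundary_tangentVector hre]
    exact (HasDerivAt.fun_sum fun k _ => (hsmooth k).2).congr_of_eventuallyEq hbd

/-- Point evaluations of a differentiable curve in the Hardy space are differentiable. -/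
lemma hasDerivAt_eval {γ : ℝ → ℂ → Matrix (Fin p) (Fin m) ℂ}
    {G : ℂ → Matrix (Fin p) (Fin m) ℂ} (hγ : ∀ᶠ t in 𝓝 0, MemH2 (γ t)) (hG : MemH2 G)
    (hd : HasDerivAt (fun t => boundary (γ t)) (boundary G) 0) {s : ℂ} (hs : 0 < s.re)
    (i : Fin p) (j : Fin m) : HasDerivAt (fun t => γ t s i j) (G s i j) 0 := by
  have hμ : (-star s).re < 0 := by simpa using hs
  have heval : ∀ F : ℂ → Matrix (Fin p) (Fin m) ℂ, MemH2 F → F s i j = (2 * Real.pi : ℂ)⁻¹ *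
      inner ℂ (boundary (pole (-star s) (Matrix.single i j 1))) (boundary F) := by
    intro F hF
    have hpi : (2 * Real.pi : ℂ) ≠ 0 := by
      exact_mod_cast (by positivity : 2 * Real.pi ≠ 0)
    have h2 : inner ℂ (vec (Matrix.single i j (1 : ℂ))) (vec (F s)) = F s i j := by
      rw [PiLp.inner_apply, Fintype.sum_prod_type, Finset.sum_eq_single i, Finset.sum_eq_single j]
      · simp [vec_apply]
      · intro l _ hl
        simp [vec_apply, Matrix.single_apply_of_ne, hl.symm]
      · simp
      · intro k _ hk
        refine Finset.sum_eq_zero fun l _ => ?_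
        simp [vec_apply, Matrix.single_apply_of_ne, hk.symm]
      · simp
    rw [← inner_conj_symm, hF.inner_boundary_pole hμ, map_mul, inner_conj_symm, map_mul,
      Complex.conj_ofReal, map_ofNat, star_neg, star_star, neg_neg, h2, inv_mul_cancel_left₀ hpi]
  have h1 := ((hasDerivAt_const (0 : ℝ)
    (boundary (pole (-star s) (Matrix.single i j (1 : ℂ))))).inner ℂ hd).const_mul
    (2 * Real.pi : ℂ)⁻¹
  rw [inner_zero_left, add_zero, ← heval G hG] at h1
  refine h1.congr_of_eventuallyEq ?_
  filter_upwards [hγ] with t ht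
  exact heval _ ht

/-- Matrix form of tangent vectors. -/
lemma tangentVector_eq {s : ℂ} :
    tangentVector lam b c x y ν s =
      outputMatrix x * (Matrix.diagonal fun k => (s - lam k)⁻¹) * inputMatrix b +
      outputMatrix c * (Matrix.diagonal fun k => (s - lam k)⁻¹) * inputMatrix y +
      outputMatrix c * (Matrix.diagonal fun k => ν k * (s - lam k)⁻¹ ^ 2) * inputMatrix b := by
  ext i j
  simp only [Matrix.add_apply, Matrix.mul_apply (M := _ * _), Matrix.mul_diagonal]
  rw [tangentVector, Finset.sum_apply, Matrix.sum_apply, ← Finset.sum_add_distrib,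
    ← Finset.sum_add_distrib]
  refine Finset.sum_congr rfl fun k _ => ?_
  simp only [pole, doublePole, Pi.add_apply, Pi.smul_apply, Matrix.add_apply, Matrix.smul_apply,
    Matrix.vecMulVec_apply, outputMatrix, inputMatrix, Matrix.transpose_apply, Matrix.of_apply,
    smul_eq_mul, Pi.star_apply]
  ring

/-- Partial fractions. -/
lemma exists_partialFractions (hlam : Function.Injective lam) (M N : Matrix (Fin r) (Fin r) ℂ) :
    ∃ (α β : Matrix (Fin r) (Fin r) ℂ) (δ : Fin r → ℂ), ∀ s, s ∉ Set.range lam →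
      (Matrix.diagonal fun k => (s - lam k)⁻¹) * (s • M - N) *
        (Matrix.diagonal fun k => (s - lam k)⁻¹) =
      (Matrix.diagonal fun k => (s - lam k)⁻¹) * α + β * (Matrix.diagonal fun k => (s - lam k)⁻¹) +
        Matrix.diagonal fun k => δ k * (s - lam k)⁻¹ ^ 2 := by
  refine ⟨Matrix.of fun k l => if k = l then M k k else
      (lam k * M k l - N k l) / (lam k - lam l),
    Matrix.of fun k l => if k = l then 0 else (lam l * M k l - N k l) / (lam l - lam k),
    fun k => lam k * M k k - N k k, fun s hs => ?_⟩
  have hne : ∀ k, s - lam k ≠ 0 := fun k => sub_ne_zero.2 fun h => hs ⟨k, h.symm⟩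
  ext k l
  simp only [Matrix.mul_diagonal, Matrix.diagonal_mul, Matrix.add_apply, Matrix.of_apply,
    Matrix.sub_apply, Matrix.smul_apply, smul_eq_mul]
  by_cases hkl : k = l
  · subst hkl
    have := hne k
    simp only [if_true, Matrix.diagonal_apply_eq]
    field_simp
    ring
  · have h1 := hne k
    have h2 := hne l
    have h3 : lam k - lam l ≠ 0 := sub_ne_zero.2 fun h => hkl (hlam h)
    have h4 : lam l - lam k ≠ 0 := sub_ne_zero.2 fun h => hkl (hlam h).symm
    simp only [if_neg hkl, Matrix.diagonal_apply_ne _ hkl, add_zero]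
    rw [← neg_sub (lam k) (lam l), div_neg]
    field_simp
    ring

/-- Variations of a diagonal descriptor realization are tangent vectors. -/
lemma exists_tangentVector_eq (hlam : Function.Injective lam) (b : Fin r → Fin m → ℂ)
    (c : Fin r → Fin p → ℂ) (X : Matrix (Fin p) (Fin r) ℂ) (Y : Matrix (Fin r) (Fin m) ℂ)
    (M N : Matrix (Fin r) (Fin r) ℂ) :
    ∃ (x : Fin r → Fin p → ℂ) (y : Fin r → Fin m → ℂ) (ν : Fin r → ℂ), ∀ s, s ∉ Set.range lam →
      X * (Matrix.diagonal fun k => (s - lam k)⁻¹) * inputMatrix b -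
        outputMatrix c * ((Matrix.diagonal fun k => (s - lam k)⁻¹) * (s • M - N) *
          (Matrix.diagonal fun k => (s - lam k)⁻¹)) * inputMatrix b +
        outputMatrix c * (Matrix.diagonal fun k => (s - lam k)⁻¹) * Y =
      tangentVector lam b c x y ν s := by
  obtain ⟨α, β, δ, h⟩ := exists_partialFractions hlam M N
  refine ⟨fun k i => (X - outputMatrix c * β) i k, fun k j => star ((Y - α * inputMatrix b) k j),
    fun k => -δ k, fun s hs => ?_⟩
  have hX : outputMatrix (fun k i => (X - outputMatrix c * β) i k) = X - outputMatrix c * β := rfl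
  have hY : inputMatrix (fun k j => star ((Y - α * inputMatrix b) k j)) =
      Y - α * inputMatrix b := by
    ext k j
    simp [inputMatrix]
  have hδ : (Matrix.diagonal fun k => -δ k * (s - lam k)⁻¹ ^ 2) =
      -(Matrix.diagonal fun k => δ k * (s - lam k)⁻¹ ^ 2) := by
    rw [Matrix.diagonal_neg]
    congr 1
    funext k
    simp
  rw [tangentVector_eq, hX, hY, hδ, h s hs]
  simp only [Matrix.mul_add, Matrix.add_mul, Matrix.mul_sub, Matrix.sub_mul, Matrix.mul_neg,
    Matrix.neg_mul, Matrix.mul_assoc]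
  abel

/-- Every velocity of a curve of stable rational functions through a pole-residue form is the
velocity of a curve of pole-residue forms. -/
theorem exists_tangentVector_of_mem_tangentSpace {F G : ℂ → Matrix (Fin p) (Fin m) ℂ}
    (hlam : Function.Injective lam) (hre : ∀ k, (lam k).re < 0) (hb : ∀ k, b k ≠ 0)
    (hc : ∀ k, c k ≠ 0) (hF : ∀ s : ℂ, 0 < s.re → F s = poleResidue lam b c s)
    (hG : G ∈ tangentSpace r m p F) :
    ∃ x y ν, ∀ s : ℂ, 0 < s.re → G s = tangentVector lam b c x y ν s := by
  obtain ⟨hGH, ε, γ, hε, hmem, -, h0, hd⟩ := hG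
  have hmem' : ∀ᶠ t in 𝓝 (0 : ℝ), γ t ∈ StableRational r m p := by
    filter_upwards [Ioo_mem_nhds (neg_lt_zero.2 hε) hε] with t ht using hmem t ht
  have hderiv := fun (s : ℂ) (hs : 0 < s.re) => hasDerivAt_eval
    (hmem'.mono fun t ht => memH2_of_mem_stableRational ht) hGH hd hs
  obtain ⟨u, v, huv⟩ := exists_directions hlam hb hc
  set μ : Fin r → ℂ := fun i => ((i : ℕ) : ℂ) + 1 with hμ
  set σ : Fin r → ℂ := fun j => ((r + (j : ℕ) : ℕ) : ℂ) + 1 with hσ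
  have hμpos : ∀ i, 0 < (μ i).re := fun i => by simp [hμ]; positivity
  have hσpos : ∀ j, 0 < (σ j).re := fun j => by simp [hσ]; positivity
  have hμσ : ∀ i j, μ i ≠ σ j := fun i j h => by
    have h' : ((i : ℕ) : ℂ) = ((r + (j : ℕ) : ℕ) : ℂ) := add_right_cancel h
    have := Nat.cast_injective h'
    have := i.2
    omega
  have hnot : ∀ s : ℂ, 0 < s.re → s ∉ Set.range lam := by
    rintro s hs ⟨k, rfl⟩
    exact lt_asymm (hre k) hs
  obtain ⟨hO, hQ⟩ := huv μ σ
    (fun i j h => Fin.ext (Nat.cast_injective (add_right_cancel h)))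
    (fun i j h => Fin.ext (by
      have := Nat.cast_injective (R := ℂ) (add_right_cancel h)
      omega)) (fun i => hnot _ (hμpos i)) fun j => hnot _ (hσpos j)
  set Λ := Matrix.diagonal lam with hΛ
  set B := inputMatrix b with hB
  set C := outputMatrix c with hC
  set O := obsMatrix Λ C u μ with hOdef
  set Q := ctrMatrix Λ B v σ with hQdef
  have hspec : ∀ s : ℂ, 0 < s.re → s ∉ spectrum ℂ Λ := fun s hs => by
    rw [hΛ, spectrum_diagonal]
    exact hnot s hs
  have h0' : ∀ s : ℂ, 0 < s.re → γ 0 s = transfer Λ B C s := fun s hs => by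
    rw [h0 s hs, hF s hs, poleResidue_eq_transfer (hnot s hs)]
  have hL0 : O * Q = loewner (γ 0) u v μ σ :=
    obsMatrix_mul_ctrMatrix (fun i => h0' _ (hμpos i)) (fun j => h0' _ (hσpos j))
      (fun i => hspec _ (hμpos i)) (fun j => hspec _ (hσpos j)) hμσ
  have hdot : ∀ s : ℂ, 0 < s.re →
      HasDerivAt (fun t => u ⬝ᵥ γ t s *ᵥ v) (u ⬝ᵥ G s *ᵥ v) 0 := by
    intro s hs
    simp only [dotProduct, Matrix.mulVec]
    exact HasDerivAt.fun_sum fun i _ => (HasDerivAt.fun_sum fun j _ =>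
      (hderiv s hs i j).mul_const (v j)).const_mul (u i)
  have dL : ∀ i j, HasDerivAt (fun t => loewner (γ t) u v μ σ i j) (loewner G u v μ σ i j) 0 :=
    fun i j => ((hdot _ (hσpos j)).sub (hdot _ (hμpos i))).const_mul _
  have dS : ∀ i j, HasDerivAt (fun t => loewnerShift (γ t) u v μ σ i j)
      (loewnerShift G u v μ σ i j) 0 :=
    fun i j => ((dL i j).const_mul _).sub (hdot _ (hμpos i))
  have dV : ∀ i j, HasDerivAt (fun t => leftValues (γ t) u μ i j) (leftValues G u μ i j) 0 :=
    fun i j => HasDerivAt.fun_sum (u := Finset.univ) fun a _ =>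
      (hderiv _ (hμpos i) a j).const_mul (u a)
  have dW : ∀ i j, HasDerivAt (fun t => rightValues (γ t) v σ i j) (rightValues G v σ i j) 0 :=
    fun i j => HasDerivAt.fun_sum (u := Finset.univ) fun a _ =>
      (hderiv _ (hσpos j) i a).mul_const (v a)
  have hdet : ∀ᶠ t in 𝓝 (0 : ℝ), (loewner (γ t) u v μ σ).det ≠ 0 := by
    have hcont : ContinuousAt (fun t => (loewner (γ t) u v μ σ).det) 0 := by
      simp only [Matrix.det_apply]
      exact tendsto_finsetSum _ fun π _ => Tendsto.const_smul
        (tendsto_finsetProd _ fun i _ => (dL (π i) i).continuousAt) _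
    refine hcont.eventually_ne ?_
    rw [← hL0, Matrix.det_mul]
    exact mul_ne_zero hO hQ
  obtain ⟨x, y, ν, hxy⟩ := exists_tangentVector_eq hlam b c (rightValues G v σ * Q⁻¹)
    (O⁻¹ * leftValues G u μ) (O⁻¹ * loewner G u v μ σ * Q⁻¹) (O⁻¹ * loewnerShift G u v μ σ * Q⁻¹)
  refine ⟨x, y, ν, fun s hs => ?_⟩
  rw [← hxy s (hnot s hs)]
  set D := Matrix.diagonal fun k => (s - lam k)⁻¹ with hD
  have hDinv : (s • (1 : Matrix (Fin r) (Fin r) ℂ) - Λ)⁻¹ = D :=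
    inv_smul_one_sub_diagonal (hnot s hs)
  set P : ℝ → Matrix (Fin r) (Fin r) ℂ := fun t =>
    s • loewner (γ t) u v μ σ - loewnerShift (γ t) u v μ σ with hP
  set P' : Matrix (Fin r) (Fin r) ℂ := s • loewner G u v μ σ - loewnerShift G u v μ σ with hP'
  have dP : ∀ i j, HasDerivAt (fun t => P t i j) (P' i j) 0 :=
    fun i j => ((dL i j).const_mul s).sub (dS i j)
  have hP0 : P 0 = O * (s • (1 : Matrix (Fin r) (Fin r) ℂ) - Λ) * Q :=
    loewnerPencil_eq (fun i => h0' _ (hμpos i)) (fun j => h0' _ (hσpos j))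
      (fun i => hspec _ (hμpos i)) (fun j => hspec _ (hσpos j)) hμσ s
  have hP0inv : (P 0)⁻¹ = Q⁻¹ * (D * O⁻¹) := by
    rw [hP0, Matrix.mul_inv_rev, Matrix.mul_inv_rev, hDinv]
  have hP0det : (P 0).det ≠ 0 := by
    rw [hP0, Matrix.det_mul, Matrix.det_mul]
    exact mul_ne_zero (mul_ne_zero hO (isUnit_det_smul_one_sub (hspec s hs)).ne_zero) hQ
  have hV0 : leftValues (γ 0) u μ = O * B := (obsMatrix_mul fun i => h0' _ (hμpos i)).symm
  have hW0 : rightValues (γ 0) v σ = C * Q := (mul_ctrMatrix fun j => h0' _ (hσpos j)).symm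
  have hrec : ∀ᶠ t in 𝓝 (0 : ℝ), γ t s =
      rightValues (γ t) v σ * (P t)⁻¹ * leftValues (γ t) u μ := by
    filter_upwards [hdet, hmem'] with t ht htm
    obtain ⟨At, Bt, Ct, hAt, -, hγt⟩ := htm
    have hAspec : ∀ z : ℂ, 0 < z.re → z ∉ spectrum ℂ At := fun z hz h => lt_asymm (hAt z h) hz
    rw [hγt s hs]
    exact transfer_eq_loewner (fun i => hγt _ (hμpos i)) (fun j => hγt _ (hσpos j))
      (fun i => hAspec _ (hμpos i)) (fun j => hAspec _ (hσpos j)) hμσ ht s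
  have hOu : IsUnit O.det := hO.isUnit
  have hQu : IsUnit Q.det := hQ.isUnit
  ext i j
  have d1 := hasDerivAt_matrix_mul (hasDerivAt_matrix_mul dW (hasDerivAt_matrix_inv dP hP0det))
    dV i j
  have d2 := (hderiv s hs i j).unique (d1.congr_of_eventuallyEq
    (hrec.mono fun t ht => congrFun (congrFun ht i) j))
  rw [d2]
  refine congrFun (congrFun ?_ i) j
  rw [hV0, hW0, hP0inv, hP']
  simp only [Matrix.add_mul, Matrix.mul_sub, Matrix.sub_mul, Matrix.mul_neg,
    Matrix.neg_mul, Matrix.mul_assoc, Matrix.nonsing_inv_mul_cancel_left _ _ hOu,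
    Matrix.mul_nonsing_inv_cancel_left _ _ hQu, Matrix.mul_smul, Matrix.smul_mul]
  abel

end Tangent

/-! ### Orthogonality to the tangent space -/

section Orthogonality

open scoped ComplexOrder

variable {r m p : ℕ} {lam : Fin r → ℂ} {b : Fin r → Fin m → ℂ} {c : Fin r → Fin p → ℂ}

lemma inner_vec_vecMulVec (M : Matrix (Fin p) (Fin m) ℂ) (x : Fin p → ℂ) (y : Fin m → ℂ) :
    inner ℂ (vec M) (vec (Matrix.vecMulVec x (star y))) = star (star x ⬝ᵥ M *ᵥ y) := by
  rw [PiLp.inner_apply, Fintype.sum_prod_type]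
  simp only [dotProduct, Matrix.mulVec, star_sum, Finset.mul_sum]
  refine Finset.sum_congr rfl fun i _ => Finset.sum_congr rfl fun j _ => ?_
  simp [vec_apply, Matrix.vecMulVec_apply]
  ring

/-- The inner product of a Hardy function with a tangent vector. -/
lemma innerH2_tangentVector {E : ℂ → Matrix (Fin p) (Fin m) ℂ} (hE : MemH2 E)
    (hre : ∀ k, (lam k).re < 0) (x : Fin r → Fin p → ℂ) (y : Fin r → Fin m → ℂ) (ν : Fin r → ℂ) :
    innerH2 E (tangentVector lam b c x y ν) =
      ∑ k, (-(ν k * star (star (c k) ⬝ᵥ derivMatrix E (-star (lam k)) *ᵥ b k)) +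
        (star (star (x k) ⬝ᵥ E (-star (lam k)) *ᵥ b k) +
          star (star (c k) ⬝ᵥ E (-star (lam k)) *ᵥ y k))) := by
  have hpi : (2 * Real.pi : ℂ) ≠ 0 := by
    exact_mod_cast (by positivity : 2 * Real.pi ≠ 0)
  rw [innerH2_eq, boundary_tangentVector hre, inner_sum, Finset.mul_sum]
  refine Finset.sum_congr rfl fun k _ => ?_
  rw [inner_add_right, inner_smul_right, hE.inner_boundary_doublePole (hre k),
    hE.inner_boundary_pole (hre k), vec_add, inner_add_right, inner_vec_vecMulVec,
    inner_vec_vecMulVec, inner_vec_vecMulVec]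
  field_simp

lemma derivMatrix_sub {F G : ℂ → Matrix (Fin p) (Fin m) ℂ} (hF : MemH2 F) (hG : MemH2 G) {s : ℂ}
    (hs : 0 < s.re) : derivMatrix (F - G) s = derivMatrix F s - derivMatrix G s :=
  vec_injective (((hF.sub hG).hasDerivAt_vec hs).unique
    ((hF.hasDerivAt_vec hs).sub (hG.hasDerivAt_vec hs)))

/-- Orthogonality to all tangent vectors as a tangential interpolation condition. -/
lemma forall_innerH2_tangentVector_eq_zero_iff {E : ℂ → Matrix (Fin p) (Fin m) ℂ} (hE : MemH2 E)
    (hre : ∀ k, (lam k).re < 0) :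
    (∀ x y ν, innerH2 E (tangentVector lam b c x y ν) = 0) ↔
      ∀ k, E (-star (lam k)) *ᵥ b k = 0 ∧ star (c k) ᵥ* E (-star (lam k)) = 0 ∧
        star (c k) ⬝ᵥ derivMatrix E (-star (lam k)) *ᵥ b k = 0 := by
  simp_rw [innerH2_tangentVector hE hre]
  constructor
  · intro h k
    refine ⟨?_, ?_, ?_⟩
    · have h1 := h (Pi.single k (E (-star (lam k)) *ᵥ b k)) 0 0
      rw [Finset.sum_eq_single k (fun l _ hl => by simp [hl]) (by simp)] at h1
      simpa [dotProduct_star_self_eq_zero] using h1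
    · have h1 := h 0 (Pi.single k (star (star (c k) ᵥ* E (-star (lam k))))) 0
      rw [Finset.sum_eq_single k (fun l _ hl => by simp [hl]) (by simp)] at h1
      rw [← dotProduct_self_star_eq_zero]
      simpa [Matrix.dotProduct_mulVec] using h1
    · have h1 := h 0 0 (Pi.single k 1)
      rw [Finset.sum_eq_single k (fun l _ hl => by simp [hl]) (by simp)] at h1
      simpa using h1
  · intro h x y ν
    refine Finset.sum_eq_zero fun k _ => ?_
    obtain ⟨h1, h2, h3⟩ := h k
    rw [h1, h3, Matrix.dotProduct_mulVec (star (c k)), h2]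
    simp

end Orthogonality

end H2Opt

end

theorem mainTheorem9 {r m p : ℕ} (H Hhat : ℂ → Matrix (Fin p) (Fin m) ℂ)
    (hH : H2Opt.MemH2 H) (hHhat : Hhat ∈ H2Opt.StableRational r m p)
    (lam : Fin r → ℂ) (b : Fin r → Fin m → ℂ) (c : Fin r → Fin p → ℂ)
    (hlam : Function.Injective lam)
    (hform : ∀ s : ℂ, 0 < s.re →
      Hhat s = ∑ i, (1 / (s - lam i)) • Matrix.vecMulVec (c i) (star (b i))) :
    (∀ G ∈ H2Opt.tangentSpace r m p Hhat, H2Opt.innerH2 (H - Hhat) G = 0) ↔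
      ∀ i : Fin r,
        Matrix.mulVec (H (-star (lam i))) (b i) = Matrix.mulVec (Hhat (-star (lam i))) (b i) ∧
        Matrix.vecMul (star (c i)) (H (-star (lam i))) =
          Matrix.vecMul (star (c i)) (Hhat (-star (lam i))) ∧
        dotProduct (star (c i))
            (Matrix.mulVec (H2Opt.derivMatrix H (-star (lam i))) (b i)) =
          dotProduct (star (c i))
            (Matrix.mulVec (H2Opt.derivMatrix Hhat (-star (lam i))) (b i)) := by
  have hF : ∀ s : ℂ, 0 < s.re → Hhat s = H2Opt.poleResidue lam b c s := by
    intro s hs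
    rw [hform s hs, H2Opt.poleResidue, Finset.sum_apply]
    simp only [H2Opt.pole, one_div]
  have hre := H2Opt.re_neg_of_mem_stableRational hHhat hlam hF
  have hne := H2Opt.vecMulVec_ne_zero_of_mem_stableRational hHhat hF
  have hb : ∀ k, b k ≠ 0 := fun k h => hne k (by ext; simp [Matrix.vecMulVec_apply, h])
  have hc : ∀ k, c k ≠ 0 := fun k h => hne k (by ext; simp [Matrix.vecMulVec_apply, h])
  have hHhat2 := H2Opt.memH2_of_mem_stableRational hHhat
  have hpos : ∀ k, 0 < (-star (lam k)).re := fun k => by simpa using hre k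
  have hT : (∀ G ∈ H2Opt.tangentSpace r m p Hhat, H2Opt.innerH2 (H - Hhat) G = 0) ↔
      ∀ x y ν, H2Opt.innerH2 (H - Hhat) (H2Opt.tangentVector lam b c x y ν) = 0 := by
    constructor
    · intro h x y ν
      exact h _ (H2Opt.tangentVector_mem_tangentSpace hlam hre hb hc hF x y ν)
    · intro h G hG
      obtain ⟨x, y, ν, hG'⟩ :=
        H2Opt.exists_tangentVector_of_mem_tangentSpace hlam hre hb hc hF hG
      rw [H2Opt.innerH2_eq, H2Opt.boundary_congr hG', ← H2Opt.innerH2_eq]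
      exact h x y ν
  rw [hT, H2Opt.forall_innerH2_tangentVector_eq_zero_iff (hH.sub hHhat2) hre]
  refine forall_congr' fun k => ?_
  rw [H2Opt.derivMatrix_sub hH hHhat2 (hpos k), Pi.sub_apply, Matrix.sub_mulVec,
    Matrix.vecMul_sub, Matrix.sub_mulVec, dotProduct_sub, sub_eq_zero, sub_eq_zero, sub_eq_zero]
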